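/- For every $\theta_1\in(0,\pi/2)$ there is a constant $C=C(\theta_1)>0$, depending on $\theta_1$ only, with the following property. Let $n\ge 2$, $T>0$, let $M^n$ be a compact smooth $n$-manifold without boundary, and let $F:M^n\times[0,T]\to\mathbb{R}^{n+1}$ be a smooth convex solution of the inverse mean curvature flow; that is, $F$ is smooth, each $F(\cdot,t)$ is an immersion whose image $M_t=F(M^n,t)$ is the boundary of a convex set with non-empty interior different from $\mathbb{R}^{n+1}$, the mean curvature $H$ of $M_t$ (the trace of the second fundamental form with respect to the induced metric, positive for round spheres) satisfies $H(p,t)>0$, and $$\frac{\partial F}{\partial t}(p,t)=\frac{1}{H(p,t)}\,\nu(p,t)\qquad\text{on } M^n\times[0,T],$$ where $\nu(\cdot,t)$ is the outward unit normal of $M_t$. Suppose that $$\langle F,e_{n+1}\rangle\ \ge\ \sin\theta_1\,|F|\qquad\text{on } M^n\times[0,T].$$ Then $F\neq 0$ and $$\frac{1}{H\,|F|}\ \le\ C\left(1+\frac{1}{t^{1/2}}\right)\qquad\text{on } M^n\times(0,T].$$ In particular the bound does not depend on $n$, on $T$, or on any positive lower bound for $H$ at time $0$. -/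

import Mathlib

open scoped Manifold ContDiff

noncomputable section

namespace IMCF

/-- `M₀` is a convex hypersurface bounding `K`: `M₀ = ∂K`, where `K` is a convex set with non-empty
interior which is not the whole space. -/
structure BoundsConvex {n : ℕ} (M₀ K : Set (EuclideanSpace ℝ (Fin (n + 1)))) : Prop where
  convex : Convex ℝ K
  nonempty_interior : (interior K).Nonempty
  ne_univ : K ≠ Set.univ
  frontier_eq : frontier K = M₀

section Geometry

variable {n : ℕ} {M : Type*} [TopologicalSpace M] [ChartedSpace (EuclideanSpace ℝ (Fin n)) M]

/-- The partial derivative `∂ᵢ f` at `p` of a map `f : M → ℝⁿ⁺¹`, with respect to the coordinates of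
the preferred chart at `p`. -/
def partialDeriv (f : M → EuclideanSpace ℝ (Fin (n + 1))) (p : M) (i : Fin n) :
    EuclideanSpace ℝ (Fin (n + 1)) :=
  mfderiv (𝓡 n) 𝓘(ℝ, EuclideanSpace ℝ (Fin (n + 1))) f p
    (EuclideanSpace.single i (1 : ℝ) : EuclideanSpace ℝ (Fin n))

/-- The induced metric `gᵢⱼ = ⟨∂ᵢ f, ∂ⱼ f⟩` at `p`. -/
def firstForm (f : M → EuclideanSpace ℝ (Fin (n + 1))) (p : M) : Matrix (Fin n) (Fin n) ℝ :=
  Matrix.of fun i j => inner ℝ (partialDeriv f p i) (partialDeriv f p j)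

/-- The second fundamental form `hᵢⱼ = ⟨∂ᵢ ν, ∂ⱼ f⟩` at `p`, for the unit normal field `ν`. -/
def secondForm (f ν : M → EuclideanSpace ℝ (Fin (n + 1))) (p : M) : Matrix (Fin n) (Fin n) ℝ :=
  Matrix.of fun i j => inner ℝ (partialDeriv ν p i) (partialDeriv f p j)

/-- The mean curvature `H = gⁱʲ hᵢⱼ` (the sum of the principal curvatures, positive for round
spheres with their outward normal). It does not depend on the coordinates. -/
def meanCurvature (f ν : M → EuclideanSpace ℝ (Fin (n + 1))) (p : M) : ℝ :=
  ((firstForm f p)⁻¹ * secondForm f ν p).trace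

/-- `ν` is the unit normal field along the immersion `f`, with image in `∂K`, `K` convex, which
points out of `K`: it has length one, is orthogonal to the tangent spaces, and `K` lies on the side
of each tangent hyperplane to which `-ν` points. -/
structure IsOutwardUnitNormal (f ν : M → EuclideanSpace ℝ (Fin (n + 1)))
    (K : Set (EuclideanSpace ℝ (Fin (n + 1)))) : Prop where
  norm_eq_one : ∀ p, ‖ν p‖ = 1
  orthogonal : ∀ p i, inner ℝ (ν p) (partialDeriv f p i) = 0
  outward : ∀ p, ∀ x ∈ K, inner ℝ (ν p) (x - f p) ≤ 0

/-- `F : M × [0, T] → ℝⁿ⁺¹` is a smooth solution to the inverse mean curvature flow by convex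
hypersurfaces `M_t = F(M, t)`, with outward unit normal `ν`. Only the values of `F` and `ν` at times
in `[0, T]` matter; time derivatives at the end points are one-sided. -/
structure IsConvexSolution (T : ℝ) (F ν : M → ℝ → EuclideanSpace ℝ (Fin (n + 1))) : Prop where
  smooth : ContMDiffOn ((𝓡 n).prod 𝓘(ℝ, ℝ)) 𝓘(ℝ, EuclideanSpace ℝ (Fin (n + 1))) ∞
    (fun q : M × ℝ => F q.1 q.2) (Set.univ ×ˢ Set.Icc 0 T)
  immersion : ∀ t ∈ Set.Icc 0 T, ∀ p, Function.Injective
    (mfderiv (𝓡 n) 𝓘(ℝ, EuclideanSpace ℝ (Fin (n + 1))) (fun q => F q t) p)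
  convex : ∀ t ∈ Set.Icc 0 T, ∃ K : Set (EuclideanSpace ℝ (Fin (n + 1))),
    BoundsConvex (Set.range fun p => F p t) K ∧
      IsOutwardUnitNormal (fun p => F p t) (fun p => ν p t) K
  meanCurvature_pos : ∀ t ∈ Set.Icc 0 T, ∀ p,
    0 < meanCurvature (fun q => F q t) (fun q => ν q t) p
  flow : ∀ t ∈ Set.Icc 0 T, ∀ p, HasDerivWithinAt (fun s => F p s)
    ((meanCurvature (fun q => F q t) (fun q => ν q t) p)⁻¹ • ν p t) (Set.Icc 0 T) t

end Geometry

end IMCF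

end

/-! The proof is a maximum principle for the speed 1/H measured against φ(x) = ⟨x, e⟩ - ε|x|, where
e is the axis of the cone and ε = sin θ₁ / 2. On the cone ε|x| ≤ φ ≤ |x|, and φ is concave, with
Hessian -ε/|x| in the directions across the radius. Put w = 1/(Hφ). The speed satisfies ∂ₜ(1/H) =
H⁻² Δ(1/H) + (|A|²/H²)(1/H), and ΔF = -Hν, so at a spatial maximum of w ∂ₜ log(1/H) + ∂ₜ log φ ≤
|A|²/H² - w² φ (ε/|F|)(n - 1). Convexity gives |A|² ≤ H², while φ ≥ ε|F| and n ≥ 2 make the last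
term at most -ε²w². A maximum in time of w² σ/(1+σ), with σ the elapsed time, bounds ∂ₜ log(1/H) -
∂ₜ log φ from below. Since |∂ₜ log φ| ≤ 2w, this leaves ε²w² ≤ 1 + 4w + 1/(2σ(1+σ)), hence a bound
for w² σ/(1+σ) by a constant depending on ε alone (`sq_mul_le_of_maximum`). The weight vanishes at σ
= 0, so no initial bound on H enters.

No connection or Laplacian is used. With V = ∂ₜF = ν/H, the matrix k = ⟨∂ᵢV, ∂ⱼF⟩ is the second
fundamental form divided by H, and the flow equation becomes tr(g⁻¹k) = 1. Its time derivative at a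
point where g = 1 (`sum_inner_dirDeriv_acceleration`) replaces the evolution equation of the speed.
The maximum conditions are read along straight coordinate lines; the tangential parts of ∂ᵢ∂ᵢF,
which a covariant derivative would remove, cancel because of the first order condition. This is
`deriv_log_speed_le`; `IsConvexSolution.bound_of_isMax` adds the time condition and
`IsConvexSolution.sq_div_norm_le` supplies the maximum point. -/

namespace IMCF

/-! ### Calculus of derivatives in constant directions. -/

section DirectionalDerivative

variable {X G : Type*} [NormedAddCommGroup X] [NormedSpace ℝ X]
  [NormedAddCommGroup G] [InnerProductSpace ℝ G] {Ω : Set X}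

/-- The derivative of `f` in the constant direction `v`. -/
noncomputable def dirDeriv {Y : Type*} [NormedAddCommGroup Y] [NormedSpace ℝ Y] (v : X)
    (f : X → Y) : X → Y :=
  fun z => fderiv ℝ f z v

variable {Y : Type*} [NormedAddCommGroup Y] [NormedSpace ℝ Y]

theorem contDiffOn_dirDeriv (hΩ : IsOpen Ω) {f : X → Y} (hf : ContDiffOn ℝ ∞ f Ω) (v : X) :
    ContDiffOn ℝ ∞ (dirDeriv v f) Ω :=
  (hf.fderiv_of_isOpen hΩ (by simp)).clm_apply contDiffOn_const

theorem differentiableAt_of_contDiffOn (hΩ : IsOpen Ω) {f : X → Y} (hf : ContDiffOn ℝ ∞ f Ω)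
    {z : X} (hz : z ∈ Ω) : DifferentiableAt ℝ f z :=
  (hf.contDiffAt (hΩ.mem_nhds hz)).differentiableAt (by simp)

theorem dirDeriv_comm (hΩ : IsOpen Ω) {f : X → Y} (hf : ContDiffOn ℝ ∞ f Ω)
    {z : X} (hz : z ∈ Ω) (v w : X) :
    dirDeriv v (dirDeriv w f) z = dirDeriv w (dirDeriv v f) z := by
  have hs : IsSymmSndFDerivAt ℝ f z :=
    (hf.contDiffAt (hΩ.mem_nhds hz)).isSymmSndFDerivAt
      (by rw [minSmoothness_of_isRCLikeNormedField]; exact WithTop.coe_le_coe.2 le_top)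
  have hd : DifferentiableAt ℝ (fderiv ℝ f) z :=
    differentiableAt_of_contDiffOn hΩ (hf.fderiv_of_isOpen hΩ (by simp)) hz
  have key : ∀ v w : X, dirDeriv v (dirDeriv w f) z = fderiv ℝ (fderiv ℝ f) z v w := by
    intro v w
    have := (hd.hasFDerivAt.clm_apply (hasFDerivAt_const w z)).fderiv
    change fderiv ℝ (fun y => fderiv ℝ f y w) z v = _
    rw [this]
    simp
  rw [key, key]
  exact hs v w

theorem dirDeriv_congr (hΩ : IsOpen Ω) {f g : X → Y} (h : Set.EqOn f g Ω) {z : X} (hz : z ∈ Ω)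
    (v : X) : dirDeriv v f z = dirDeriv v g z := by
  have : f =ᶠ[nhds z] g := Filter.eventuallyEq_of_mem (hΩ.mem_nhds hz) h
  simp only [dirDeriv, this.fderiv_eq]

theorem dirDeriv_add_dir (f : X → Y) (v w : X) :
    dirDeriv (v + w) f = fun z => dirDeriv v f z + dirDeriv w f z := by
  ext z; simp [dirDeriv]

theorem dirDeriv_smul_dir (f : X → Y) (c : ℝ) (v : X) :
    dirDeriv (c • v) f = fun z => c • dirDeriv v f z := by
  ext z; simp [dirDeriv]

theorem dirDeriv_add (hΩ : IsOpen Ω) {f g : X → Y} (hf : ContDiffOn ℝ ∞ f Ω)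
    (hg : ContDiffOn ℝ ∞ g Ω) {z : X} (hz : z ∈ Ω) (v : X) :
    dirDeriv v (fun y => f y + g y) z = dirDeriv v f z + dirDeriv v g z := by
  have := fderiv_fun_add (differentiableAt_of_contDiffOn hΩ hf hz)
    (differentiableAt_of_contDiffOn hΩ hg hz)
  simp [dirDeriv, this]

theorem dirDeriv_const_smul (hΩ : IsOpen Ω) {f : X → Y} (hf : ContDiffOn ℝ ∞ f Ω)
    {z : X} (hz : z ∈ Ω) (c : ℝ) (v : X) :
    dirDeriv v (fun y => c • f y) z = c • dirDeriv v f z := by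
  have := fderiv_fun_const_smul (differentiableAt_of_contDiffOn hΩ hf hz) c
  simp [dirDeriv, this]

theorem dirDeriv_const (c : Y) (z v : X) : dirDeriv v (fun _ : X => c) z = 0 := by
  simp [dirDeriv]

theorem dirDeriv_inner (hΩ : IsOpen Ω) {f g : X → G} (hf : ContDiffOn ℝ ∞ f Ω)
    (hg : ContDiffOn ℝ ∞ g Ω) {z : X} (hz : z ∈ Ω) (v : X) :
    dirDeriv v (fun y => inner ℝ (f y) (g y)) z
      = inner ℝ (dirDeriv v f z) (g z) + inner ℝ (f z) (dirDeriv v g z) := by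
  rw [dirDeriv, fderiv_inner_apply ℝ (differentiableAt_of_contDiffOn hΩ hf hz)
    (differentiableAt_of_contDiffOn hΩ hg hz), add_comm]
  rfl

theorem dirDeriv_mul (hΩ : IsOpen Ω) {f g : X → ℝ} (hf : ContDiffOn ℝ ∞ f Ω)
    (hg : ContDiffOn ℝ ∞ g Ω) {z : X} (hz : z ∈ Ω) (v : X) :
    dirDeriv v (fun y => f y * g y) z = dirDeriv v f z * g z + f z * dirDeriv v g z := by
  have := fderiv_fun_mul (differentiableAt_of_contDiffOn hΩ hf hz)
    (differentiableAt_of_contDiffOn hΩ hg hz)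
  simp [dirDeriv, this]
  ring

theorem hasDerivAt_line {f : X → Y} {z v : X} {s : ℝ} (hf : DifferentiableAt ℝ f (z + s • v)) :
    HasDerivAt (fun r : ℝ => f (z + r • v)) (dirDeriv v f (z + s • v)) s := by
  have h1 : HasDerivAt (fun r : ℝ => z + r • v) v s := by
    simpa using ((hasDerivAt_id s).smul_const v).const_add z
  exact hf.hasFDerivAt.comp_hasDerivAt s h1

theorem eventually_line_mem (hΩ : IsOpen Ω) {z : X} (hz : z ∈ Ω) (v : X) :
    ∀ᶠ s : ℝ in nhds 0, z + s • v ∈ Ω := by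
  have hc : Continuous fun s : ℝ => z + s • v := by fun_prop
  exact hc.continuousAt.eventually (by simpa using hΩ.mem_nhds hz)

theorem deriv_deriv_line (hΩ : IsOpen Ω) {q : X → ℝ} (hq : ContDiffOn ℝ ∞ q Ω)
    {z : X} (hz : z ∈ Ω) (v : X) :
    deriv (deriv fun s : ℝ => q (z + s • v)) 0 = dirDeriv v (dirDeriv v q) z := by
  have h1 : deriv (fun s : ℝ => q (z + s • v)) =ᶠ[nhds 0] fun s => dirDeriv v q (z + s • v) := by
    filter_upwards [eventually_line_mem hΩ hz v] with s hs
    exact (hasDerivAt_line (differentiableAt_of_contDiffOn hΩ hq hs)).deriv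
  rw [h1.deriv_eq]
  have hz' : z + (0 : ℝ) • v ∈ Ω := by simpa using hz
  have := (hasDerivAt_line (differentiableAt_of_contDiffOn hΩ
    (contDiffOn_dirDeriv hΩ hq v) hz')).deriv
  simpa using this

/-- First and second order conditions at a minimum along a line. -/
theorem dirDeriv_of_isLocalMin (hΩ : IsOpen Ω) {q : X → ℝ} (hq : ContDiffOn ℝ ∞ q Ω)
    {z : X} (hz : z ∈ Ω) (v : X) (hmin : IsLocalMin (fun s : ℝ => q (z + s • v)) 0) :
    dirDeriv v q z = 0 ∧ 0 ≤ dirDeriv v (dirDeriv v q) z := by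
  have hz' : z + (0 : ℝ) • v ∈ Ω := by simpa using hz
  have hd := hasDerivAt_line (differentiableAt_of_contDiffOn hΩ hq hz')
  refine ⟨by simpa using hmin.hasDerivAt_eq_zero hd, ?_⟩
  by_contra! hneg
  rw [← deriv_deriv_line hΩ hq hz v] at hneg
  -- A negative second derivative would make the point a local maximum as well, so the function
  -- would be locally constant and its second derivative zero.
  have hmax : IsLocalMax (fun s : ℝ => q (z + s • v)) 0 :=
    isLocalMax_of_deriv_deriv_neg hneg hmin.deriv_eq_zero hd.continuousAt
  have hc : (fun s : ℝ => q (z + s • v)) =ᶠ[nhds 0] fun _ => q (z + (0 : ℝ) • v) := by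
    filter_upwards [hmin, hmax] with s h1 h2 using le_antisymm h2 h1
  have : deriv (deriv fun s : ℝ => q (z + s • v)) 0 = 0 := by
    rw [hc.deriv.deriv_eq]
    simp
  linarith

theorem dirDeriv_of_isLocalMax (hΩ : IsOpen Ω) {q : X → ℝ} (hq : ContDiffOn ℝ ∞ q Ω)
    {z : X} (hz : z ∈ Ω) (v : X) (hmax : IsLocalMax (fun s : ℝ => q (z + s • v)) 0) :
    dirDeriv v (dirDeriv v q) z ≤ 0 := by
  have h := (dirDeriv_of_isLocalMin hΩ (q := fun y => (-1 : ℝ) • q y) (hq.const_smul (-1 : ℝ)) hz v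
    (by simpa using hmax.neg)).2
  have h2 : Set.EqOn (dirDeriv v fun y => (-1 : ℝ) • q y) (fun y => (-1 : ℝ) • dirDeriv v q y) Ω :=
    fun y hy => dirDeriv_const_smul hΩ hq hy _ v
  rw [dirDeriv_congr hΩ h2 hz, dirDeriv_const_smul hΩ (contDiffOn_dirDeriv hΩ hq v) hz] at h
  simpa using h

end DirectionalDerivative

/-! ### Differentiating a trace identity. -/

section Matrix

open Matrix

attribute [local instance] Matrix.linftyOpNormedRing Matrix.linftyOpNormedAlgebra

/-- Expansion in matrix units reduces the claim to the entries. The operator norm, a local instance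
here, gives the normed ring in which inversion can be differentiated. -/
theorem hasDerivAt_matrix {ι : Type*} [Fintype ι] [DecidableEq ι] {g : ℝ → Matrix ι ι ℝ}
    {g' : Matrix ι ι ℝ} {t : ℝ} (h : ∀ i j, HasDerivAt (fun s => g s i j) (g' i j) t) :
    HasDerivAt g g' t := by
  have h1 : HasDerivAt (fun s => ∑ i, ∑ j, g s i j • Matrix.single i j (1 : ℝ))
      (∑ i, ∑ j, g' i j • Matrix.single i j (1 : ℝ)) t :=
    HasDerivAt.fun_sum fun i _ => HasDerivAt.fun_sum fun j _ => (h i j).smul_const _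
  have h2 : ∀ A : Matrix ι ι ℝ, ∑ i, ∑ j, A i j • Matrix.single i j (1 : ℝ) = A := by
    intro A
    conv_rhs => rw [Matrix.matrix_eq_sum_single A]
    simp
  simpa only [h2] using h1

/-- If `tr (g⁻¹ k) = 1` for all times, then `tr k' = tr (g' k)` at a time when `g = 1`. -/
theorem trace_deriv_eq_of_trace_inv_mul {ι : Type*} [Fintype ι] [DecidableEq ι]
    {g k : ℝ → Matrix ι ι ℝ} {g' k' : Matrix ι ι ℝ} {t : ℝ}
    (hg : ∀ i j, HasDerivAt (fun s => g s i j) (g' i j) t)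
    (hk : ∀ i j, HasDerivAt (fun s => k s i j) (k' i j) t)
    (h1 : g t = 1) (htr : ∀ᶠ s in nhds t, ((g s)⁻¹ * k s).trace = 1) :
    k'.trace = (g' * k t).trace := by
  have hG := hasDerivAt_matrix hg
  have hK := hasDerivAt_matrix hk
  have hI : HasDerivAt (fun s => (g s)⁻¹) (-g') t := by
    have hR := hasFDerivAt_ringInverse (𝕜 := ℝ) (1 : (Matrix ι ι ℝ)ˣ)
    have hR' : HasFDerivAt Ring.inverse
        (-((ContinuousLinearMap.mulLeftRight ℝ (Matrix ι ι ℝ)) ↑(1 : (Matrix ι ι ℝ)ˣ)⁻¹)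
          ↑(1 : (Matrix ι ι ℝ)ˣ)⁻¹) (g t) := by
      rw [h1]; exact hR
    have := hR'.comp_hasDerivAt t hG
    simp only [Matrix.nonsing_inv_eq_ringInverse]
    convert! this using 1
    simp
  have hM := hI.mul hK
  have hT : HasDerivAt (fun s => ((g s)⁻¹ * k s).trace)
      ((-g' * k t + (g t)⁻¹ * k').trace) t :=
    (LinearMap.toContinuousLinearMap (Matrix.traceLinearMap ι ℝ ℝ)).hasFDerivAt.comp_hasDerivAt t hM
  have h0 : HasDerivAt (fun s => ((g s)⁻¹ * k s).trace) 0 t :=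
    (hasDerivAt_const t (1 : ℝ)).congr_of_eventuallyEq htr
  have := hT.unique h0
  rw [h1] at this
  simp [Matrix.trace_add] at this
  linarith

end Matrix

/-! ### Evolution of the speed, and convexity. -/

section Evolution

variable {X G : Type*} [NormedAddCommGroup X] [NormedSpace ℝ X]
  [NormedAddCommGroup G] [InnerProductSpace ℝ G] {Ω : Set X} {n : ℕ}

/-- The matrix `⟨∂_{bᵢ} f, ∂_{bⱼ} f⟩`. -/
noncomputable def metricMatrix (b : Fin n → X) (f : X → G) (z : X) : Matrix (Fin n) (Fin n) ℝ :=
  Matrix.of fun i j => inner ℝ (dirDeriv (b i) f z) (dirDeriv (b j) f z)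

/-- The matrix `⟨∂_{bᵢ} ∂_τ f, ∂_{bⱼ} f⟩`; when `∂_τ f` is normal it is the second fundamental form
multiplied by the length of `∂_τ f`. -/
noncomputable def velocityMatrix (τ : X) (b : Fin n → X) (f : X → G) (z : X) :
    Matrix (Fin n) (Fin n) ℝ :=
  Matrix.of fun i j => inner ℝ (dirDeriv (b i) (dirDeriv τ f) z) (dirDeriv (b j) f z)

variable {f : X → G} {τ : X} {b : Fin n → X} {z : X}

/-- The derivative of the orthogonality relation `hn`, which links the two usual expressions of the
second fundamental form. -/
theorem inner_dirDeriv_velocity (hΩ : IsOpen Ω) (hf : ContDiffOn ℝ ∞ f Ω)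
    (hn : ∀ y ∈ Ω, ∀ i, inner ℝ (dirDeriv τ f y) (dirDeriv (b i) f y) = (0 : ℝ))
    (hz : z ∈ Ω) (v : X) (j : Fin n) :
    inner ℝ (dirDeriv v (dirDeriv τ f) z) (dirDeriv (b j) f z)
      = -inner ℝ (dirDeriv τ f z) (dirDeriv v (dirDeriv (b j) f) z) := by
  have h := dirDeriv_inner hΩ (contDiffOn_dirDeriv hΩ hf τ) (contDiffOn_dirDeriv hΩ hf (b j)) hz v
  rw [dirDeriv_congr hΩ (g := fun _ => (0 : ℝ)) (fun y hy => hn y hy j) hz, dirDeriv_const] at h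
  linarith

theorem velocityMatrix_symm (hΩ : IsOpen Ω) (hf : ContDiffOn ℝ ∞ f Ω)
    (hn : ∀ y ∈ Ω, ∀ i, inner ℝ (dirDeriv τ f y) (dirDeriv (b i) f y) = (0 : ℝ))
    (hz : z ∈ Ω) (i j : Fin n) :
    velocityMatrix τ b f z i j = velocityMatrix τ b f z j i := by
  simp only [velocityMatrix, Matrix.of_apply]
  rw [inner_dirDeriv_velocity hΩ hf hn hz, inner_dirDeriv_velocity hΩ hf hn hz,
    dirDeriv_comm hΩ hf hz]

/-- The tangential part of the acceleration is minus half the gradient of the squared speed. Thus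
second derivatives of the squared speed can be expressed by first derivatives of the acceleration,
which the time derivative of the trace identity controls. -/
theorem inner_acceleration (hΩ : IsOpen Ω) (hf : ContDiffOn ℝ ∞ f Ω)
    (hn : ∀ y ∈ Ω, ∀ i, inner ℝ (dirDeriv τ f y) (dirDeriv (b i) f y) = (0 : ℝ))
    (hz : z ∈ Ω) (j : Fin n) :
    inner ℝ (dirDeriv τ (dirDeriv τ f) z) (dirDeriv (b j) f z)
      = -inner ℝ (dirDeriv τ f z) (dirDeriv (b j) (dirDeriv τ f) z) := by
  rw [inner_dirDeriv_velocity hΩ hf hn hz, dirDeriv_comm hΩ hf hz τ (b j)]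

/-- This is the evolution equation of the speed in disguise: since k is symmetric, the metric has
time derivative 2k, so differentiating tr(g⁻¹k) = 1 gives tr k' = 2|k|². The left side is tr k'
after commuting derivatives. -/
theorem sum_inner_dirDeriv_acceleration (hΩ : IsOpen Ω) (hf : ContDiffOn ℝ ∞ f Ω)
    (hn : ∀ y ∈ Ω, ∀ i, inner ℝ (dirDeriv τ f y) (dirDeriv (b i) f y) = (0 : ℝ))
    (hz : z ∈ Ω) (h1 : metricMatrix b f z = 1)
    (htr : ∀ᶠ s : ℝ in nhds 0,
      ((metricMatrix b f (z + s • τ))⁻¹ * velocityMatrix τ b f (z + s • τ)).trace = 1) :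
    ∑ i, (inner ℝ (dirDeriv (b i) (dirDeriv τ (dirDeriv τ f)) z) (dirDeriv (b i) f z)
        + ‖dirDeriv (b i) (dirDeriv τ f) z‖ ^ 2)
      = 2 * ∑ i, ∑ j, velocityMatrix τ b f z i j ^ 2 := by
  have hfi := fun i => contDiffOn_dirDeriv hΩ hf (b i)
  have hV := contDiffOn_dirDeriv hΩ hf τ
  have hVi := fun i => contDiffOn_dirDeriv hΩ hV (b i)
  have hz0 : z + (0 : ℝ) • τ ∈ Ω := by simpa using hz
  have hg : ∀ i j, HasDerivAt (fun s : ℝ => metricMatrix b f (z + s • τ) i j)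
      ((Matrix.of fun i j => velocityMatrix τ b f z i j + velocityMatrix τ b f z j i) i j) 0 := by
    intro i j
    have := hasDerivAt_line (differentiableAt_of_contDiffOn hΩ ((hfi i).inner ℝ (hfi j)) hz0)
    rw [dirDeriv_inner hΩ (hfi i) (hfi j) hz0, zero_smul, add_zero, dirDeriv_comm hΩ hf hz,
      dirDeriv_comm hΩ hf hz τ (b j), real_inner_comm (dirDeriv (b j) (dirDeriv τ f) z) (dirDeriv (b i) f z)] at this
    exact this
  have hk : ∀ i j, HasDerivAt (fun s : ℝ => velocityMatrix τ b f (z + s • τ) i j)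
      ((Matrix.of fun i j =>
        inner ℝ (dirDeriv (b i) (dirDeriv τ (dirDeriv τ f)) z) (dirDeriv (b j) f z)
        + inner ℝ (dirDeriv (b i) (dirDeriv τ f) z) (dirDeriv (b j) (dirDeriv τ f) z)) i j) 0 := by
    intro i j
    have := hasDerivAt_line (differentiableAt_of_contDiffOn hΩ ((hVi i).inner ℝ (hfi j)) hz0)
    rw [dirDeriv_inner hΩ (hVi i) (hfi j) hz0, zero_smul, add_zero, dirDeriv_comm hΩ hV hz,
      dirDeriv_comm hΩ hf hz τ (b j)] at this
    exact this
  have key := trace_deriv_eq_of_trace_inv_mul hg hk (by simpa using h1) htr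
  simp only [Matrix.trace, Matrix.diag, Matrix.of_apply, Matrix.mul_apply, zero_smul, add_zero,
    real_inner_self_eq_norm_sq] at key
  rw [key, Finset.mul_sum]
  refine Finset.sum_congr rfl fun i _ => ?_
  rw [Finset.mul_sum]
  refine Finset.sum_congr rfl fun j _ => ?_
  rw [velocityMatrix_symm hΩ hf hn hz j i]
  ring

/-- If the image lies on one side of the tangent space, the second fundamental form is
non-negative. -/
theorem velocityMatrix_nonneg (hΩ : IsOpen Ω) (hf : ContDiffOn ℝ ∞ f Ω)
    (hn : ∀ y ∈ Ω, ∀ i, inner ℝ (dirDeriv τ f y) (dirDeriv (b i) f y) = (0 : ℝ))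
    (hz : z ∈ Ω)
    (hout : ∀ v ∈ Submodule.span ℝ (Set.range b), ∀ᶠ s : ℝ in nhds 0,
      inner ℝ (dirDeriv τ f z) (f (z + s • v) - f z) ≤ (0 : ℝ))
    (i j : Fin n) (x y : ℝ) :
    0 ≤ x ^ 2 * velocityMatrix τ b f z i i + 2 * x * y * velocityMatrix τ b f z i j
      + y ^ 2 * velocityMatrix τ b f z j j := by
  set N := dirDeriv τ f z with hN
  set v := x • b i + y • b j with hv
  have hvm : v ∈ Submodule.span ℝ (Set.range b) :=
    Submodule.add_mem _ (Submodule.smul_mem _ _ (Submodule.subset_span ⟨i, rfl⟩))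
      (Submodule.smul_mem _ _ (Submodule.subset_span ⟨j, rfl⟩))
  have hc : ContDiffOn ℝ ∞ (fun _ : X => N) Ω := contDiffOn_const
  -- The height ⟨N, f⟩ has a maximum along the line, and its second derivative there is minus the
  -- value of k on v.
  have hmax : IsLocalMax (fun s : ℝ => inner ℝ N (f (z + s • v))) 0 := by
    filter_upwards [hout v hvm] with s hs
    rw [inner_sub_right] at hs
    simpa using hs
  have h2 := dirDeriv_of_isLocalMax hΩ (q := fun y => inner ℝ N (f y)) (hc.inner ℝ hf) hz v hmax
  have hd : ∀ (g : X → G), ContDiffOn ℝ ∞ g Ω → ∀ w, ∀ p ∈ Ω,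
      dirDeriv w (fun y => inner ℝ N (g y)) p = inner ℝ N (dirDeriv w g p) := by
    intro g hg w p hp
    rw [dirDeriv_inner hΩ hc hg hp, dirDeriv_const]
    simp
  rw [dirDeriv_congr hΩ (fun p hp => hd f hf v p hp) hz, hd _ (contDiffOn_dirDeriv hΩ hf v) v z hz]
    at h2
  have hfi := fun i => contDiffOn_dirDeriv hΩ hf (b i)
  have hexp : ∀ w, dirDeriv w (dirDeriv v f) z
      = x • dirDeriv w (dirDeriv (b i) f) z + y • dirDeriv w (dirDeriv (b j) f) z := by
    intro w
    rw [hv, dirDeriv_add_dir, dirDeriv_smul_dir, dirDeriv_smul_dir,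
      dirDeriv_add hΩ ((hfi i).const_smul x) ((hfi j).const_smul y) hz,
      dirDeriv_const_smul hΩ (hfi i) hz, dirDeriv_const_smul hΩ (hfi j) hz]
  have hexp' : ∀ (g : X → G), dirDeriv v g z = x • dirDeriv (b i) g z + y • dirDeriv (b j) g z := by
    intro g
    rw [hv, dirDeriv_add_dir, dirDeriv_smul_dir, dirDeriv_smul_dir]
  rw [hexp, hexp', hexp'] at h2
  simp only [inner_add_right, inner_smul_right] at h2
  have hs := velocityMatrix_symm hΩ hf hn hz i j
  simp only [velocityMatrix, Matrix.of_apply, inner_dirDeriv_velocity hΩ hf hn hz] at hs ⊢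
  rw [← hN] at hs ⊢
  rw [← neg_inj.1 hs] at h2
  linarith

theorem sq_le_mul_of_quadratic_nonneg {a b c : ℝ}
    (h : ∀ x y : ℝ, 0 ≤ x ^ 2 * a + 2 * x * y * b + y ^ 2 * c) : b ^ 2 ≤ a * c := by
  have hd := discrim_le_zero (a := a) (b := 2 * b) (c := c) fun x => by
    have := h x 1
    nlinarith
  rw [discrim] at hd
  nlinarith

/-- This is |A|² ≤ H² for a convex hypersurface. Non-negativity on the planes spanned by pairs of
directions gives kᵢⱼ² ≤ kᵢᵢkⱼⱼ, and summing finishes without diagonalisation. -/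
theorem sum_sq_velocityMatrix_le (hΩ : IsOpen Ω) (hf : ContDiffOn ℝ ∞ f Ω)
    (hn : ∀ y ∈ Ω, ∀ i, inner ℝ (dirDeriv τ f y) (dirDeriv (b i) f y) = (0 : ℝ))
    (hz : z ∈ Ω)
    (hout : ∀ v ∈ Submodule.span ℝ (Set.range b), ∀ᶠ s : ℝ in nhds 0,
      inner ℝ (dirDeriv τ f z) (f (z + s • v) - f z) ≤ (0 : ℝ)) :
    ∑ i, ∑ j, velocityMatrix τ b f z i j ^ 2 ≤ (velocityMatrix τ b f z).trace ^ 2 := by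
  calc ∑ i, ∑ j, velocityMatrix τ b f z i j ^ 2
      ≤ ∑ i, ∑ j, velocityMatrix τ b f z i i * velocityMatrix τ b f z j j :=
        Finset.sum_le_sum fun i _ => Finset.sum_le_sum fun j _ =>
          sq_le_mul_of_quadratic_nonneg (velocityMatrix_nonneg hΩ hf hn hz hout i j)
    _ = (velocityMatrix τ b f z).trace ^ 2 := by
        rw [sq, Matrix.trace, Finset.sum_mul_sum]
        rfl

end Evolution

/-! ### The comparison function and the inequality at a spatial maximum. -/

section MaximumPoint

variable {X G : Type*} [NormedAddCommGroup X] [NormedSpace ℝ X]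
  [NormedAddCommGroup G] [InnerProductSpace ℝ G] {Ω : Set X} {n : ℕ}

/-- The function `x ↦ ⟨x, e⟩ - ε |x|`, positive and concave on a cone around `e`. -/
noncomputable def coneFunction (e : G) (ε : ℝ) (x : G) : ℝ := inner ℝ x e - ε * ‖x‖

variable {f : X → G} {τ : X} {b : Fin n → X} {z : X}

theorem norm_mul_dirDeriv_norm (hΩ : IsOpen Ω) (hf : ContDiffOn ℝ ∞ f Ω)
    (h0 : ∀ y ∈ Ω, f y ≠ 0) (hz : z ∈ Ω) (v : X) :
    ‖f z‖ * dirDeriv v (fun y => ‖f y‖) z = inner ℝ (dirDeriv v f z) (f z) := by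
  have hN : ContDiffOn ℝ ∞ (fun y => ‖f y‖) Ω := hf.norm ℝ h0
  have h1 := dirDeriv_inner hΩ hf hf hz v
  have h2 := dirDeriv_mul hΩ hN hN hz v
  simp only [real_inner_self_eq_norm_mul_norm] at h1
  rw [real_inner_comm (dirDeriv v f z)] at h1
  linarith

/-- One more derivative of r ∂ᵥr = ⟨∂ᵥf, f⟩, where r = ‖f‖; the factor r is kept to avoid
differentiating a quotient. -/
theorem norm_mul_dirDeriv_dirDeriv_norm (hΩ : IsOpen Ω) (hf : ContDiffOn ℝ ∞ f Ω)
    (h0 : ∀ y ∈ Ω, f y ≠ 0) (hz : z ∈ Ω) (v : X) :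
    ‖f z‖ * dirDeriv v (dirDeriv v fun y => ‖f y‖) z
      = inner ℝ (dirDeriv v (dirDeriv v f) z) (f z) + ‖dirDeriv v f z‖ ^ 2
        - (dirDeriv v (fun y => ‖f y‖) z) ^ 2 := by
  have hN : ContDiffOn ℝ ∞ (fun y => ‖f y‖) Ω := hf.norm ℝ h0
  have h1 := dirDeriv_mul hΩ hN (contDiffOn_dirDeriv hΩ hN v) hz v
  rw [dirDeriv_congr hΩ (fun y hy => norm_mul_dirDeriv_norm hΩ hf h0 hy v) hz,
    dirDeriv_inner hΩ (contDiffOn_dirDeriv hΩ hf v) hf hz, real_inner_self_eq_norm_sq] at h1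
  linarith

theorem contDiffOn_coneFunction (e : G) (ε : ℝ) (hf : ContDiffOn ℝ ∞ f Ω)
    (h0 : ∀ y ∈ Ω, f y ≠ 0) : ContDiffOn ℝ ∞ (fun y => coneFunction e ε (f y)) Ω :=
  (hf.inner ℝ contDiffOn_const).sub (contDiffOn_const.mul (hf.norm ℝ h0))

theorem dirDeriv_coneFunction (hΩ : IsOpen Ω) (e : G) (ε : ℝ) (hf : ContDiffOn ℝ ∞ f Ω)
    (h0 : ∀ y ∈ Ω, f y ≠ 0) (hz : z ∈ Ω) (v : X) :
    dirDeriv v (fun y => coneFunction e ε (f y)) z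
      = inner ℝ (dirDeriv v f z) e + (-ε) * dirDeriv v (fun y => ‖f y‖) z := by
  have hN : ContDiffOn ℝ ∞ (fun y => ‖f y‖) Ω := hf.norm ℝ h0
  have he : ContDiffOn ℝ ∞ (fun _ : X => e) Ω := contDiffOn_const
  have hfun : (fun y => coneFunction e ε (f y)) = fun y => inner ℝ (f y) e + (-ε) • ‖f y‖ := by
    ext y
    simp [coneFunction]
    ring
  rw [hfun, dirDeriv_add hΩ (hf.inner ℝ he) (hN.const_smul (-ε)) hz, dirDeriv_inner hΩ hf he hz,
    dirDeriv_const_smul hΩ hN hz, dirDeriv_const, inner_zero_right, add_zero, smul_eq_mul]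

theorem dirDeriv_coneFunction_eq_inner (hΩ : IsOpen Ω) (e : G) (ε : ℝ) (hf : ContDiffOn ℝ ∞ f Ω)
    (h0 : ∀ y ∈ Ω, f y ≠ 0) (hz : z ∈ Ω) (v : X) :
    dirDeriv v (fun y => coneFunction e ε (f y)) z
      = inner ℝ (dirDeriv v f z) (e - (ε / ‖f z‖) • f z) := by
  have hr0 : ‖f z‖ ≠ 0 := norm_ne_zero_iff.2 (h0 z hz)
  rw [dirDeriv_coneFunction hΩ e ε hf h0 hz, inner_sub_right, inner_smul_right,
    ← norm_mul_dirDeriv_norm hΩ hf h0 hz v]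
  field_simp
  ring

theorem dirDeriv_dirDeriv_coneFunction (hΩ : IsOpen Ω) (e : G) (ε : ℝ) (hf : ContDiffOn ℝ ∞ f Ω)
    (h0 : ∀ y ∈ Ω, f y ≠ 0) (hz : z ∈ Ω) (v : X) :
    dirDeriv v (dirDeriv v fun y => coneFunction e ε (f y)) z
      = inner ℝ (dirDeriv v (dirDeriv v f) z) e
        + (-ε) * dirDeriv v (dirDeriv v fun y => ‖f y‖) z := by
  have hN : ContDiffOn ℝ ∞ (fun y => ‖f y‖) Ω := hf.norm ℝ h0
  have he : ContDiffOn ℝ ∞ (fun _ : X => e) Ω := contDiffOn_const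
  have hN' := contDiffOn_dirDeriv hΩ hN v
  have hf' := contDiffOn_dirDeriv hΩ hf v
  have hfun : Set.EqOn (dirDeriv v fun y => coneFunction e ε (f y))
      (fun y => inner ℝ (dirDeriv v f y) e + (-ε) • dirDeriv v (fun y => ‖f y‖) y) Ω :=
    fun y hy => dirDeriv_coneFunction hΩ e ε hf h0 hy v
  rw [dirDeriv_congr hΩ hfun hz, dirDeriv_add hΩ (hf'.inner ℝ he) (hN'.const_smul (-ε)) hz,
    dirDeriv_inner hΩ hf' he hz, dirDeriv_const_smul hΩ hN' hz, dirDeriv_const, inner_zero_right,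
    add_zero, smul_eq_mul]

/-- Expansion of the inner product in an adapted orthonormal frame. -/
theorem inner_eq_of_adapted_frame (hdim : Module.finrank ℝ G = n + 1) {u : Fin n → G} {N : G}
    (hu : ∀ i j, inner ℝ (u i) (u j) = if i = j then (1 : ℝ) else 0) (hN : N ≠ 0)
    (huN : ∀ i, inner ℝ N (u i) = (0 : ℝ)) (x y : G) :
    inner ℝ x y = inner ℝ x N * inner ℝ N y / ‖N‖ ^ 2 + ∑ i, inner ℝ x (u i) * inner ℝ (u i) y := by
  have hN' : ‖N‖ ≠ 0 := norm_ne_zero_iff.2 hN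
  let B : Fin (n + 1) → G := Fin.cons (‖N‖⁻¹ • N) u
  have hB : Orthonormal ℝ B := by
    rw [orthonormal_iff_ite]
    intro i j
    refine Fin.cases ?_ (fun i => ?_) i <;> refine Fin.cases ?_ (fun j => ?_) j
    · simp only [B, Fin.cons_zero, inner_smul_left, inner_smul_right, real_inner_self_eq_norm_sq]
      simp
      field_simp
    · simp [B, inner_smul_left, huN, (Fin.succ_ne_zero j).symm]
    · simp [B, inner_smul_right, real_inner_comm N, huN]
    · simp [B, hu]
  have hfd : FiniteDimensional ℝ G := Module.finite_of_finrank_pos (by omega)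
  let O : OrthonormalBasis (Fin (n + 1)) ℝ G :=
    OrthonormalBasis.mk hB (by
      rw [hB.linearIndependent.span_eq_top_of_card_eq_finrank (by simp [hdim])])
  have := O.sum_inner_mul_inner x y
  rw [← this, Fin.sum_univ_succ]
  simp only [O, OrthonormalBasis.coe_mk, B, Fin.cons_zero, Fin.cons_succ, inner_smul_left,
    inner_smul_right]
  congr 1
  simp
  field_simp

/-- The differential inequality satisfied by the logarithm of `|∂_τ f| / φ(f)` at a spatial
maximum point. -/
theorem deriv_log_speed_le (hΩ : IsOpen Ω) (hf : ContDiffOn ℝ ∞ f Ω)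
    (hdim : Module.finrank ℝ G = n + 1)
    (hn : ∀ y ∈ Ω, ∀ i, inner ℝ (dirDeriv τ f y) (dirDeriv (b i) f y) = (0 : ℝ))
    (hz : z ∈ Ω) (h1 : metricMatrix b f z = 1)
    (htr : ∀ᶠ s : ℝ in nhds 0,
      ((metricMatrix b f (z + s • τ))⁻¹ * velocityMatrix τ b f (z + s • τ)).trace = 1)
    (hout : ∀ v ∈ Submodule.span ℝ (Set.range b), ∀ᶠ s : ℝ in nhds 0,
      inner ℝ (dirDeriv τ f z) (f (z + s • v) - f z) ≤ (0 : ℝ))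
    (h0 : ∀ y ∈ Ω, f y ≠ 0) (hV0 : dirDeriv τ f z ≠ 0) {e : G} {ε w : ℝ} (hε : 0 ≤ ε)
    (hφ : 0 < coneFunction e ε (f z))
    (hw : ‖dirDeriv τ f z‖ = w * coneFunction e ε (f z))
    (hmax : ∀ i, ∀ᶠ s : ℝ in nhds 0, ‖dirDeriv τ f (z + s • b i)‖ ^ 2
      ≤ w ^ 2 * coneFunction e ε (f (z + s • b i)) ^ 2) :
    inner ℝ (dirDeriv τ (dirDeriv τ f) z) (dirDeriv τ f z) / ‖dirDeriv τ f z‖ ^ 2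
      + inner ℝ (dirDeriv τ f z) (e - (ε / ‖f z‖) • f z) / coneFunction e ε (f z)
      ≤ 1 - w ^ 2 * coneFunction e ε (f z) * (ε / ‖f z‖) * (n - 1) := by
  have hfi := fun i => contDiffOn_dirDeriv hΩ hf (b i)
  have hV := contDiffOn_dirDeriv hΩ hf τ
  have hW := contDiffOn_dirDeriv hΩ hV τ
  have hVi := fun i => contDiffOn_dirDeriv hΩ hV (b i)
  have hc := contDiffOn_coneFunction e ε hf h0
  have hci := fun i => contDiffOn_dirDeriv hΩ hc (b i)
  set φ := coneFunction e ε (f z) with hφdef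
  set r := ‖f z‖ with hr
  have hr0 : 0 < r := norm_pos_iff.2 (h0 z hz)
  set a := e - (ε / r) • f z with ha
  set V := dirDeriv τ f with hVdef
  set W := dirDeriv τ V with hWdef
  set u := fun i => dirDeriv (b i) f z with hudef
  set S := fun i => dirDeriv (b i) (dirDeriv (b i) f) z with hSdef
  set k := velocityMatrix τ b f z with hkdef
  have hu : ∀ i j, inner ℝ (u i) (u j) = if i = j then (1 : ℝ) else 0 := by
    intro i j
    have := congrFun (congrFun h1 i) j
    rwa [Matrix.one_apply] at this
  have hframe := inner_eq_of_adapted_frame hdim hu hV0 (hn z hz)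
  have hV2 : ‖V z‖ ^ 2 ≠ 0 := pow_ne_zero _ (norm_ne_zero_iff.2 hV0)
  have hw0 : w ≠ 0 := by
    rintro rfl
    exact hV0 (norm_eq_zero.1 (by simpa using hw))
  -- derivatives of the comparison function
  have hφ1 : ∀ i, dirDeriv (b i) (fun y => coneFunction e ε (f y)) z = inner ℝ (u i) a :=
    fun i => dirDeriv_coneFunction_eq_inner hΩ e ε hf h0 hz (b i)
  have hφ2 : ∀ i, dirDeriv (b i) (dirDeriv (b i) fun y => coneFunction e ε (f y)) z
      = inner ℝ (S i) a - ε / r * (1 - (inner ℝ (u i) (f z) / r) ^ 2) := by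
    intro i
    have h := norm_mul_dirDeriv_norm hΩ hf h0 hz (b i)
    have h' := norm_mul_dirDeriv_dirDeriv_norm hΩ hf h0 hz (b i)
    have hui : ‖dirDeriv (b i) f z‖ ^ 2 = 1 := by
      rw [← real_inner_self_eq_norm_sq]
      simpa using hu i i
    rw [dirDeriv_dirDeriv_coneFunction hΩ e ε hf h0 hz, ha, inner_sub_right, inner_smul_right,
      ← h, mul_div_cancel_left₀ _ hr0.ne']
    rw [hui] at h'
    have h'' : dirDeriv (b i) (dirDeriv (b i) fun y => ‖f y‖) z = (inner ℝ (S i) (f z) + 1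
        - (dirDeriv (b i) (fun y => ‖f y‖) z) ^ 2) / r := by
      rw [eq_div_iff hr0.ne', mul_comm]
      exact h'
    rw [h'']
    ring
  have hacc : ∀ i, ∀ y ∈ Ω, inner ℝ (W y) (dirDeriv (b i) f y)
      = -inner ℝ (V y) (dirDeriv (b i) V y) :=
    fun i y hy => inner_acceleration hΩ hf hn hy i
  have hQ : ∀ i, w ^ 2 * φ * inner ℝ (u i) a = inner ℝ (V z) (dirDeriv (b i) V z) ∧
      0 ≤ w ^ 2 * (inner ℝ (u i) a ^ 2
        + φ * (inner ℝ (S i) a - ε / r * (1 - (inner ℝ (u i) (f z) / r) ^ 2)))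
        + inner ℝ (dirDeriv (b i) W z) (u i) + inner ℝ (W z) (S i) := by
    intro i
    have hq1 : ContDiffOn ℝ ∞
        (fun y => w ^ 2 • (coneFunction e ε (f y) * coneFunction e ε (f y))) Ω :=
      (hc.mul hc).const_smul _
    have hq2 : ContDiffOn ℝ ∞ (fun y => (-1 : ℝ) • inner ℝ (V y) (V y)) Ω :=
      (hV.inner ℝ hV).const_smul _
    -- The function w²φ² - |V|² is zero at z by `hw` and non-negative nearby on the line; using
    -- squares keeps both terms smooth.
    have hmin : IsLocalMin (fun s : ℝ => (fun y => w ^ 2 • (coneFunction e ε (f y)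
        * coneFunction e ε (f y)) + (-1 : ℝ) • inner ℝ (V y) (V y)) (z + s • b i)) 0 := by
      filter_upwards [hmax i] with s hs
      simp only [real_inner_self_eq_norm_sq, zero_smul, add_zero, smul_eq_mul, hw]
      nlinarith
    obtain ⟨hd1, hd2⟩ := dirDeriv_of_isLocalMin hΩ (hq1.add hq2) hz (b i) hmin
    -- The relation `hacc` holds on all of Ω, so ⟨V, ∂ᵢV⟩ is replaced by -⟨W, ∂ᵢf⟩ before the second
    -- differentiation, and no second spatial derivative of V appears.
    have hD : Set.EqOn (dirDeriv (b i) fun y => w ^ 2 • (coneFunction e ε (f y)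
        * coneFunction e ε (f y)) + (-1 : ℝ) • inner ℝ (V y) (V y))
        (fun y => (2 * w ^ 2) • (coneFunction e ε (f y)
          * dirDeriv (b i) (fun y => coneFunction e ε (f y)) y)
          + (2 : ℝ) • inner ℝ (W y) (dirDeriv (b i) f y)) Ω := by
      intro y hy
      rw [dirDeriv_add hΩ hq1 hq2 hy, dirDeriv_const_smul hΩ (hc.mul hc) hy,
        dirDeriv_const_smul hΩ (hV.inner ℝ hV) hy, dirDeriv_mul hΩ hc hc hy,
        dirDeriv_inner hΩ hV hV hy, real_inner_comm (V y)]
      simp only [hacc i y hy, smul_eq_mul]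
      ring
    rw [hD hz] at hd1
    rw [dirDeriv_congr hΩ hD hz, dirDeriv_add hΩ ((hc.mul (hci i)).const_smul _)
      ((hW.inner ℝ (hfi i)).const_smul _) hz, dirDeriv_const_smul hΩ (hc.mul (hci i)) hz,
      dirDeriv_const_smul hΩ (hW.inner ℝ (hfi i)) hz, dirDeriv_mul hΩ hc (hci i) hz,
      dirDeriv_inner hΩ hW (hfi i) hz, hφ1, hφ2] at hd2
    simp only [hφ1, hacc i z hz, smul_eq_mul] at hd1
    simp only [smul_eq_mul] at hd2
    constructor
    · linarith
    · change 0 ≤ 2 * w ^ 2 * (inner ℝ (u i) a * inner ℝ (u i) a + φ * (inner ℝ (S i) a - _))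
        + 2 * (_ + inner ℝ (W z) (S i)) at hd2
      linarith
  have htrk : k.trace = 1 := by
    have := htr.self_of_nhds
    simpa [h1] using this
  have hkk : ∑ i, ∑ j, k i j ^ 2 ≤ 1 := by
    have := sum_sq_velocityMatrix_le hΩ hf hn hz hout
    rwa [← hkdef, htrk, one_pow] at this
  have hev := sum_inner_dirDeriv_acceleration hΩ hf hn hz h1 htr
  -- the derivative of the normal part of the velocity
  have hVi2 : ∀ i, ‖dirDeriv (b i) V z‖ ^ 2 = w ^ 2 * inner ℝ (u i) a ^ 2 + ∑ j, k i j ^ 2 := by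
    intro i
    rw [← real_inner_self_eq_norm_sq, hframe, real_inner_comm (V z), ← (hQ i).1, hw]
    congr 1
    · field_simp
    · refine Finset.sum_congr rfl fun j _ => ?_
      rw [real_inner_comm (dirDeriv (b i) V z) (u j), sq]
      rfl
  have hVS : ∑ i, inner ℝ (V z) (S i) = -1 := by
    rw [← htrk, Matrix.trace, ← Finset.sum_neg_distrib]
    refine Finset.sum_congr rfl fun i _ => ?_
    simp only [Matrix.diag, hkdef, velocityMatrix, Matrix.of_apply,
      inner_dirDeriv_velocity hΩ hf hn hz, neg_neg, hSdef, hVdef]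
  -- By the first order condition, W + w²φa is orthogonal to all tangent vectors, hence a multiple
  -- of V. Only the normal parts of the S i survive, and these sum to -1 against V.
  have hZ : ∑ i, (inner ℝ (W z) (S i) + w ^ 2 * φ * inner ℝ (S i) a)
      = -((inner ℝ (W z) (V z) + w ^ 2 * φ * inner ℝ (V z) a) / ‖V z‖ ^ 2) := by
    have hi : ∀ i, inner ℝ (W z) (S i) + w ^ 2 * φ * inner ℝ (S i) a
        = (inner ℝ (W z) (V z) + w ^ 2 * φ * inner ℝ (V z) a) / ‖V z‖ ^ 2
          * inner ℝ (V z) (S i) := by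
      intro i
      have h := hframe (W z + (w ^ 2 * φ) • a) (S i)
      have hzero : ∀ j, inner ℝ (W z + (w ^ 2 * φ) • a) (u j) = (0 : ℝ) := by
        intro j
        rw [inner_add_left, inner_smul_left, hacc j z hz, ← (hQ j).1, real_inner_comm (u j)]
        simp
      simp only [hzero, zero_mul, Finset.sum_const_zero, add_zero, inner_add_left, inner_smul_left,
        RCLike.conj_to_real] at h
      rw [real_inner_comm (S i) a, real_inner_comm (V z) a] at *
      rw [h]
      ring
    rw [Finset.sum_congr rfl fun i _ => hi i, ← Finset.mul_sum, hVS]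
    ring
  -- The tangential part of f/|f| has length at most one. This costs one of the n directions and
  -- leaves the factor n - 1.
  have hbessel : ∑ i, (inner ℝ (u i) (f z) / r) ^ 2 ≤ 1 := by
    have h := hframe (f z) (f z)
    have h3 : 0 ≤ inner ℝ (f z) (V z) * inner ℝ (V z) (f z) / ‖V z‖ ^ 2 := by
      rw [real_inner_comm (f z)]
      exact div_nonneg (mul_self_nonneg _) (sq_nonneg _)
    rw [real_inner_self_eq_norm_sq, ← hr] at h
    simp only [div_pow]
    rw [← Finset.sum_div, div_le_one (by positivity)]
    calc ∑ i, inner ℝ (u i) (f z) ^ 2 = ∑ i, inner ℝ (f z) (u i) * inner ℝ (u i) (f z) :=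
          Finset.sum_congr rfl fun i _ => by rw [real_inner_comm (u i), sq]
      _ ≤ r ^ 2 := by linarith
  have hsum := Finset.sum_nonneg fun i (_ : i ∈ Finset.univ) => (hQ i).2
  have hsplit : ∑ i, (w ^ 2 * (inner ℝ (u i) a ^ 2
        + φ * (inner ℝ (S i) a - ε / r * (1 - (inner ℝ (u i) (f z) / r) ^ 2)))
        + inner ℝ (dirDeriv (b i) W z) (u i) + inner ℝ (W z) (S i))
      = ∑ i, (inner ℝ (dirDeriv (b i) W z) (u i) + ‖dirDeriv (b i) V z‖ ^ 2)
        - ∑ i, ∑ j, k i j ^ 2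
        + ∑ i, (inner ℝ (W z) (S i) + w ^ 2 * φ * inner ℝ (S i) a)
        - w ^ 2 * φ * (ε / r) * (n - ∑ i, (inner ℝ (u i) (f z) / r) ^ 2) := by
    have hcard : (n : ℝ) = ∑ _i : Fin n, (1 : ℝ) := by simp
    rw [hcard, ← Finset.sum_sub_distrib, ← Finset.sum_sub_distrib, Finset.mul_sum,
      ← Finset.sum_add_distrib, ← Finset.sum_sub_distrib]
    refine Finset.sum_congr rfl fun i _ => ?_
    rw [hVi2]
    ring
  rw [hsplit, hZ] at hsum
  have hev' : ∑ i, (inner ℝ (dirDeriv (b i) W z) (u i) + ‖dirDeriv (b i) V z‖ ^ 2)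
      = 2 * ∑ i, ∑ j, k i j ^ 2 := hev
  rw [hev'] at hsum
  have hcoef : 0 ≤ w ^ 2 * φ * (ε / r) := by positivity
  have hfin := mul_le_mul_of_nonneg_left hbessel hcoef
  -- Since |V| = wφ, the factor w²φ/|V|² is 1/φ.
  have hquot : w ^ 2 * φ * inner ℝ (V z) a / ‖V z‖ ^ 2 = inner ℝ (V z) a / φ := by
    rw [hw]
    field_simp
  rw [add_div, hquot] at hsum
  nlinarith

end MaximumPoint

/-! ### Passing to a frame orthonormal at one point, and the numerical estimate. -/

section Coordinates

variable {X G : Type*} [NormedAddCommGroup X] [NormedSpace ℝ X]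
  [NormedAddCommGroup G] [InnerProductSpace ℝ G] {Ω : Set X} {n : ℕ}
  {f : X → G} {τ : X} {z : X}

theorem dirDeriv_sum_smul_dir (f : X → G) (c : Fin n → ℝ) (e : Fin n → X) (z : X) :
    dirDeriv (∑ j, c j • e j) f z = ∑ j, c j • dirDeriv (e j) f z := by
  simp [dirDeriv, map_sum]

theorem metricMatrix_sum_smul (A : Matrix (Fin n) (Fin n) ℝ) (e : Fin n → X) (f : X → G) (z : X) :
    metricMatrix (fun i => ∑ j, A i j • e j) f z = A * metricMatrix e f z * A.transpose := by
  ext i j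
  simp only [metricMatrix, Matrix.of_apply, dirDeriv_sum_smul_dir, sum_inner, inner_sum,
    Matrix.mul_apply, Matrix.transpose_apply, Finset.sum_mul, Finset.mul_sum, inner_smul_left, inner_smul_right]
  refine Finset.sum_congr rfl fun k _ => Finset.sum_congr rfl fun l _ => ?_
  simp
  ring

theorem velocityMatrix_sum_smul (A : Matrix (Fin n) (Fin n) ℝ) (e : Fin n → X) (f : X → G)
    (z : X) :
    velocityMatrix τ (fun i => ∑ j, A i j • e j) f z
      = A * velocityMatrix τ e f z * A.transpose := by
  ext i j
  simp only [velocityMatrix, Matrix.of_apply, dirDeriv_sum_smul_dir, sum_inner, inner_sum,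
    Matrix.mul_apply, Matrix.transpose_apply, Finset.sum_mul, Finset.mul_sum, inner_smul_left, inner_smul_right]
  refine Finset.sum_congr rfl fun k _ => Finset.sum_congr rfl fun l _ => ?_
  simp
  ring

theorem posSemidef_metricMatrix (e : Fin n → X) (f : X → G) (z : X) :
    (metricMatrix e f z).PosSemidef :=
  Matrix.posSemidef_gram ℝ fun i => dirDeriv (e i) f z

-- Positivity in the C⋆-algebra of matrices gives g = BᵀB, and A = (Bᵀ)⁻¹ works.
open scoped ComplexOrder MatrixOrder Matrix.Norms.L2Operator in
theorem exists_mul_mul_transpose_eq_one {g : Matrix (Fin n) (Fin n) ℝ} (hg : g.PosSemidef)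
    (hdet : g.det ≠ 0) : ∃ A : Matrix (Fin n) (Fin n) ℝ, IsUnit A.det ∧ A * g * A.transpose = 1 := by
  obtain ⟨B, hB⟩ := CStarAlgebra.nonneg_iff_eq_star_mul_self.1 hg.nonneg
  rw [Matrix.star_eq_conjTranspose, Matrix.conjTranspose_eq_transpose_of_trivial] at hB
  have hBu : IsUnit B.det := by
    rw [isUnit_iff_ne_zero]
    intro h
    apply hdet
    rw [hB, Matrix.det_mul, h, mul_zero]
  have hBt : IsUnit B.transpose.det := by rwa [Matrix.det_transpose]
  refine ⟨(B.transpose)⁻¹, ?_, ?_⟩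
  · exact Matrix.isUnit_nonsing_inv_det _ hBt
  · rw [hB, Matrix.transpose_nonsing_inv, Matrix.transpose_transpose, ← mul_assoc,
      Matrix.nonsing_inv_mul _ hBt, one_mul, Matrix.mul_nonsing_inv _ hBu]

/-- Under a constant change of basis g⁻¹k is conjugated by Aᵀ. One matrix A, chosen at the maximum
point, thus preserves the trace identity at all nearby times. -/
theorem trace_inv_conj_mul_conj {A g k : Matrix (Fin n) (Fin n) ℝ} (hA : IsUnit A.det) :
    ((A * g * A.transpose)⁻¹ * (A * k * A.transpose)).trace = (g⁻¹ * k).trace := by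
  have hAt : IsUnit A.transpose.det := by rwa [Matrix.det_transpose]
  have h : (A * g * A.transpose)⁻¹ * (A * k * A.transpose)
      = A.transpose⁻¹ * (g⁻¹ * k) * A.transpose := by
    rw [Matrix.mul_inv_rev, Matrix.mul_inv_rev]
    calc A.transpose⁻¹ * (g⁻¹ * A⁻¹) * (A * k * A.transpose)
        = A.transpose⁻¹ * (g⁻¹ * (A⁻¹ * A) * k) * A.transpose := by simp only [mul_assoc]
      _ = _ := by rw [Matrix.nonsing_inv_mul _ hA, mul_one]
  rw [h, Matrix.trace_mul_comm, ← mul_assoc, Matrix.mul_nonsing_inv _ hAt, one_mul]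

/-- The differential inequality for the speed at a maximum point, in arbitrary coordinates. -/
theorem deriv_log_speed_le_of_coordinates (hΩ : IsOpen Ω) (hf : ContDiffOn ℝ ∞ f Ω)
    (hdim : Module.finrank ℝ G = n + 1) {c : Fin n → X}
    (hn : ∀ y ∈ Ω, ∀ v ∈ Submodule.span ℝ (Set.range c),
      inner ℝ (dirDeriv τ f y) (dirDeriv v f y) = (0 : ℝ))
    (hz : z ∈ Ω)
    (htr : ∀ᶠ s : ℝ in nhds 0,
      ((metricMatrix c f (z + s • τ))⁻¹ * velocityMatrix τ c f (z + s • τ)).trace = 1)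
    (hout : ∀ v ∈ Submodule.span ℝ (Set.range c), ∀ᶠ s : ℝ in nhds 0,
      inner ℝ (dirDeriv τ f z) (f (z + s • v) - f z) ≤ (0 : ℝ))
    (h0 : ∀ y ∈ Ω, f y ≠ 0) (hV0 : dirDeriv τ f z ≠ 0) {e : G} {ε w : ℝ} (hε : 0 ≤ ε)
    (hφ : 0 < coneFunction e ε (f z))
    (hw : ‖dirDeriv τ f z‖ = w * coneFunction e ε (f z))
    (hmax : ∀ v ∈ Submodule.span ℝ (Set.range c), ∀ᶠ s : ℝ in nhds 0,
      ‖dirDeriv τ f (z + s • v)‖ ^ 2 ≤ w ^ 2 * coneFunction e ε (f (z + s • v)) ^ 2) :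
    inner ℝ (dirDeriv τ (dirDeriv τ f) z) (dirDeriv τ f z) / ‖dirDeriv τ f z‖ ^ 2
      + inner ℝ (dirDeriv τ f z) (e - (ε / ‖f z‖) • f z) / coneFunction e ε (f z)
      ≤ 1 - w ^ 2 * coneFunction e ε (f z) * (ε / ‖f z‖) * (n - 1) := by
  -- A singular matrix has inverse 0 by convention, which would make the trace 0 instead of 1; so
  -- the trace identity already contains non-degeneracy of the metric.
  have hdet : (metricMatrix c f z).det ≠ 0 := by
    intro h
    have h1 := htr.self_of_nhds
    rw [zero_smul, add_zero, Matrix.nonsing_inv_apply_not_isUnit _ (by simp [h])] at h1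
    simp at h1
  obtain ⟨A, hA, hA1⟩ := exists_mul_mul_transpose_eq_one (posSemidef_metricMatrix c f z) hdet
  set b : Fin n → X := fun i => ∑ j, A i j • c j with hb
  have hbm : ∀ i, b i ∈ Submodule.span ℝ (Set.range c) := fun i =>
    Submodule.sum_mem _ fun j _ => Submodule.smul_mem _ _ (Submodule.subset_span ⟨j, rfl⟩)
  have hbs : Submodule.span ℝ (Set.range b) ≤ Submodule.span ℝ (Set.range c) := by
    rw [Submodule.span_le]
    rintro _ ⟨i, rfl⟩
    exact hbm i
  refine deriv_log_speed_le hΩ hf hdim (b := b) (fun y hy i => hn y hy _ (hbm i)) hz ?_ ?_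
    (fun v hv => hout v (hbs hv)) h0 hV0 hε hφ hw fun i => hmax _ (hbm i)
  · rw [hb, metricMatrix_sum_smul, hA1]
  · filter_upwards [htr] with s hs
    rw [hb, metricMatrix_sum_smul, velocityMatrix_sum_smul, trace_inv_conj_mul_conj hA, hs]

/-- The numerical form of the estimate at a maximum point of
`(|∂_τ f| / φ(f))² σ / (1 + σ)`. -/
theorem sq_mul_le_of_maximum {ε w σ β r a' b' m : ℝ} (hε : 0 < ε) (hw : 0 < w) (hσ : 0 < σ)
    (hr : 0 < r) (hm : 1 ≤ m) (hβ : ε * r ≤ β) (hb : |b'| ≤ 2 * w)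
    (h1 : a' + b' ≤ 1 - w ^ 2 * β * (ε / r) * m)
    (h2 : 0 ≤ 2 * (a' - b') + 1 / σ - 1 / (1 + σ)) :
    w ^ 2 * (σ / (1 + σ)) ≤ 2 / ε ^ 2 * (3 / 2 + 8 / ε ^ 2) := by
  have hβ0 : 0 < β := lt_of_lt_of_le (by positivity) hβ
  have hβr : ε ^ 2 ≤ β * (ε / r) := by
    rw [mul_div_assoc', le_div_iff₀ hr]
    nlinarith
  have hcoef : w ^ 2 * ε ^ 2 ≤ w ^ 2 * β * (ε / r) * m := by
    have h3 : w ^ 2 * ε ^ 2 * 1 ≤ w ^ 2 * (β * (ε / r)) * m :=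
      mul_le_mul (mul_le_mul_of_nonneg_left hβr (sq_nonneg w)) hm zero_le_one (by positivity)
    nlinarith
  have hb1 := neg_abs_le b'
  have hfrac : 1 / σ - 1 / (1 + σ) ≤ 1 / σ * (1 / (1 + σ)) := by
    apply le_of_eq
    field_simp
    ring
  -- Eliminating a': `h1` bounds a' + b' above and half of `h2` bounds a' - b' below. What remains
  -- is 2b', at most 4w in size.
  have h4 : ε ^ 2 * w ^ 2 ≤ 1 + 4 * w + 1 / 2 * (1 / σ * (1 / (1 + σ))) := by nlinarith
  -- Young's inequality absorbs the linear term into half of ε²w².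
  have h5 : 4 * w ≤ ε ^ 2 / 2 * w ^ 2 + 8 / ε ^ 2 := by
    have h6 : 0 ≤ (ε * w - 4 / ε) ^ 2 := sq_nonneg _
    have h7 : (ε * w - 4 / ε) ^ 2 = ε ^ 2 * w ^ 2 - 8 * w + 16 / ε ^ 2 := by
      field_simp
      ring
    have h8 : 16 / ε ^ 2 = 2 * (8 / ε ^ 2) := by ring
    linarith
  have h9 : ε ^ 2 / 2 * w ^ 2 ≤ 1 + 8 / ε ^ 2 + 1 / 2 * (1 / σ * (1 / (1 + σ))) := by linarith
  have hρ : 0 ≤ σ / (1 + σ) := by positivity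
  have hρ1 : σ / (1 + σ) ≤ 1 := by
    rw [div_le_one (by positivity)]
    linarith
  have h10 := mul_le_mul_of_nonneg_right h9 hρ
  -- The weight σ/(1+σ) cancels the singularity at σ = 0 coming from its own logarithmic derivative
  -- 1/(σ(1+σ)).
  have h11 : (1 / σ * (1 / (1 + σ))) * (σ / (1 + σ)) ≤ 1 := by
    have : (1 / σ * (1 / (1 + σ))) * (σ / (1 + σ)) = (1 / (1 + σ)) ^ 2 := by
      field_simp
    rw [this]
    have h12 : 1 / (1 + σ) ≤ 1 := by
      rw [div_le_one (by positivity)]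
      linarith
    exact pow_le_one₀ (by positivity) h12
  have h13 : ε ^ 2 / 2 * (w ^ 2 * (σ / (1 + σ))) ≤ 3 / 2 + 8 / ε ^ 2 := by
    have h14 : (1 + 8 / ε ^ 2) * (σ / (1 + σ)) ≤ 1 + 8 / ε ^ 2 :=
      mul_le_of_le_one_right (by positivity) hρ1
    nlinarith
  calc w ^ 2 * (σ / (1 + σ)) = 2 / ε ^ 2 * (ε ^ 2 / 2 * (w ^ 2 * (σ / (1 + σ)))) := by
        field_simp
    _ ≤ _ := mul_le_mul_of_nonneg_left h13 (by positivity)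

end Coordinates

/-! ### Reading maps on the manifold in a chart. -/

section Chart

variable {n : ℕ} {M : Type*} [TopologicalSpace M] [ChartedSpace (EuclideanSpace ℝ (Fin n)) M]

/-- The family of immersions in the preferred coordinates at `p`. -/
noncomputable def chartMap (F : M → ℝ → EuclideanSpace ℝ (Fin (n + 1))) (p : M) :
    EuclideanSpace ℝ (Fin n) × ℝ → EuclideanSpace ℝ (Fin (n + 1)) :=
  fun y => F ((extChartAt (𝓡 n) p).symm y.1) y.2

theorem chartMap_extChartAt (F : M → ℝ → EuclideanSpace ℝ (Fin (n + 1))) {p q : M}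
    (hq : q ∈ (extChartAt (𝓡 n) p).source) (t : ℝ) :
    chartMap F p (extChartAt (𝓡 n) p q, t) = F q t := by
  simp only [chartMap, (extChartAt (𝓡 n) p).left_inv hq]

theorem contMDiff_slice {S : Set ℝ} {F : M → ℝ → EuclideanSpace ℝ (Fin (n + 1))}
    (hF : ContMDiffOn ((𝓡 n).prod 𝓘(ℝ, ℝ)) 𝓘(ℝ, EuclideanSpace ℝ (Fin (n + 1))) ∞
      (fun q : M × ℝ => F q.1 q.2) (Set.univ ×ˢ S)) {t : ℝ} (ht : t ∈ S) :
    ContMDiff (𝓡 n) 𝓘(ℝ, EuclideanSpace ℝ (Fin (n + 1))) ∞ fun q => F q t := by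
  rw [← contMDiffOn_univ]
  exact hF.comp (contMDiff_id.prodMk contMDiff_const).contMDiffOn fun q _ => ⟨Set.mem_univ _, ht⟩

theorem contDiffOn_trajectory {S : Set ℝ} {F : M → ℝ → EuclideanSpace ℝ (Fin (n + 1))}
    (hF : ContMDiffOn ((𝓡 n).prod 𝓘(ℝ, ℝ)) 𝓘(ℝ, EuclideanSpace ℝ (Fin (n + 1))) ∞
      (fun q : M × ℝ => F q.1 q.2) (Set.univ ×ˢ S)) (p : M) :
    ContDiffOn ℝ ∞ (fun t => F p t) S := by
  rw [← contMDiffOn_iff_contDiffOn]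
  exact hF.comp (contMDiff_const.prodMk contMDiff_id).contMDiffOn fun q hq => ⟨Set.mem_univ _, hq⟩

theorem mfderiv_eq_sum_partialDeriv (g : M → EuclideanSpace ℝ (Fin (n + 1))) (p : M)
    (v : EuclideanSpace ℝ (Fin n)) :
    (mfderiv (𝓡 n) 𝓘(ℝ, EuclideanSpace ℝ (Fin (n + 1))) g p v : EuclideanSpace ℝ (Fin (n + 1)))
      = ∑ i, v i • partialDeriv g p i := by
  have hv : v = ∑ i, v i • (EuclideanSpace.single i (1 : ℝ) : EuclideanSpace ℝ (Fin n)) := by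
    have := (EuclideanSpace.basisFun (Fin n) ℝ).sum_repr v
    simpa using this.symm
  let L : EuclideanSpace ℝ (Fin n) →L[ℝ] EuclideanSpace ℝ (Fin (n + 1)) :=
    mfderiv (𝓡 n) 𝓘(ℝ, EuclideanSpace ℝ (Fin (n + 1))) g p
  change L v = ∑ i, v i • L (EuclideanSpace.single i (1 : ℝ))
  conv_lhs => rw [hv]
  simp only [map_sum, map_smul]

variable [IsManifold (𝓡 n) ∞ M]

/-- The manifold derivative at p is taken in the preferred chart at p, so at the centre of that
chart the two agree. Regularity is asked only of the local expression N, which makes the lemma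
applicable to ν, whose smoothness is not assumed. -/
theorem mfderiv_eq_fderiv_of_chart {g : M → EuclideanSpace ℝ (Fin (n + 1))} {p : M}
    {N : EuclideanSpace ℝ (Fin n) → EuclideanSpace ℝ (Fin (n + 1))}
    (hN : ∀ x ∈ (extChartAt (𝓡 n) p).target, g ((extChartAt (𝓡 n) p).symm x) = N x)
    (hd : DifferentiableAt ℝ N (extChartAt (𝓡 n) p p)) :
    mfderiv (𝓡 n) 𝓘(ℝ, EuclideanSpace ℝ (Fin (n + 1))) g p
      = fderiv ℝ N (extChartAt (𝓡 n) p p) := by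
  have : IsManifold (𝓡 n) 1 M := IsManifold.of_le (n := ∞) (by exact_mod_cast le_top)
  have hg : g =ᶠ[nhds p] N ∘ extChartAt (𝓡 n) p := by
    filter_upwards [extChartAt_source_mem_nhds (I := 𝓡 n) p] with q hq
    rw [Function.comp_apply, ← hN _ ((extChartAt (𝓡 n) p).map_source hq),
      (extChartAt (𝓡 n) p).left_inv hq]
  have hm : MDifferentiableAt (𝓡 n) 𝓘(ℝ, EuclideanSpace ℝ (Fin (n + 1))) g p :=
    (hd.mdifferentiableAt.comp p
      (mdifferentiableAt_extChartAt (mem_chart_source _ p))).congr_of_eventuallyEq hg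
  have hw : writtenInExtChartAt (𝓡 n) 𝓘(ℝ, EuclideanSpace ℝ (Fin (n + 1))) p g
      =ᶠ[nhds (extChartAt (𝓡 n) p p)] N := by
    filter_upwards [extChartAt_target_mem_nhds (I := 𝓡 n) p] with x hx
    exact hN x hx
  rw [hm.mfderiv, ModelWithCorners.range_eq_univ, fderivWithin_univ, hw.fderiv_eq]

theorem contDiffOn_chartMap {S : Set ℝ} {F : M → ℝ → EuclideanSpace ℝ (Fin (n + 1))}
    (hF : ContMDiffOn ((𝓡 n).prod 𝓘(ℝ, ℝ)) 𝓘(ℝ, EuclideanSpace ℝ (Fin (n + 1))) ∞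
      (fun q : M × ℝ => F q.1 q.2) (Set.univ ×ˢ S)) (p : M) :
    ContDiffOn ℝ ∞ (chartMap F p) ((extChartAt (𝓡 n) p).target ×ˢ S) := by
  rw [← contMDiffOn_iff_contDiffOn]
  have h1 : ContMDiffOn 𝓘(ℝ, EuclideanSpace ℝ (Fin n) × ℝ) (𝓡 n) ∞
      (fun y : EuclideanSpace ℝ (Fin n) × ℝ => (extChartAt (𝓡 n) p).symm y.1)
      ((extChartAt (𝓡 n) p).target ×ˢ S) :=
    (contMDiffOn_extChartAt_symm p).comp (contMDiff_iff_contDiff.2 contDiff_fst).contMDiffOn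
      fun y hy => hy.1
  have h2 : ContMDiffOn 𝓘(ℝ, EuclideanSpace ℝ (Fin n) × ℝ) 𝓘(ℝ, ℝ) ∞
      (fun y : EuclideanSpace ℝ (Fin n) × ℝ => y.2) ((extChartAt (𝓡 n) p).target ×ˢ S) :=
    (contMDiff_iff_contDiff.2 contDiff_snd).contMDiffOn
  exact hF.comp (h1.prodMk h2) fun y hy => ⟨Set.mem_univ _, hy.2⟩

/-- The derivative in any chart is a tangent vector. -/
theorem fderiv_comp_extChartAt_symm {g : M → EuclideanSpace ℝ (Fin (n + 1))}
    (hg : ContMDiff (𝓡 n) 𝓘(ℝ, EuclideanSpace ℝ (Fin (n + 1))) ∞ g) (p : M)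
    {x : EuclideanSpace ℝ (Fin n)} (hx : x ∈ (extChartAt (𝓡 n) p).target)
    (v : EuclideanSpace ℝ (Fin n)) :
    ∃ c : Fin n → ℝ, fderiv ℝ (g ∘ (extChartAt (𝓡 n) p).symm) x v
      = ∑ i, c i • partialDeriv g ((extChartAt (𝓡 n) p).symm x) i := by
  have h1 : MDifferentiableAt 𝓘(ℝ, EuclideanSpace ℝ (Fin n)) (𝓡 n) (extChartAt (𝓡 n) p).symm x :=
    ((contMDiffOn_extChartAt_symm (n := ∞) p).contMDiffAt
      ((isOpen_extChartAt_target p).mem_nhds hx)).mdifferentiableAt (by simp)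
  have h2 : MDifferentiableAt (𝓡 n) 𝓘(ℝ, EuclideanSpace ℝ (Fin (n + 1))) g
      ((extChartAt (𝓡 n) p).symm x) := hg.mdifferentiableAt (by simp)
  rw [← mfderiv_eq_fderiv, mfderiv_comp x h2 h1]
  exact ⟨_, mfderiv_eq_sum_partialDeriv g _ _⟩

end Chart

/-! ### The flow in coordinates. -/

section Solution

variable {n : ℕ} {M : Type*} [TopologicalSpace M] [ChartedSpace (EuclideanSpace ℝ (Fin n)) M]
  {T : ℝ} {F ν : M → ℝ → EuclideanSpace ℝ (Fin (n + 1))}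

namespace IsConvexSolution

/-- The mean curvature `H(p, t)` along a solution. -/
noncomputable abbrev curvature (F ν : M → ℝ → EuclideanSpace ℝ (Fin (n + 1))) (p : M) (t : ℝ) : ℝ :=
  meanCurvature (fun q => F q t) (fun q => ν q t) p

theorem norm_normal (h : IsConvexSolution T F ν) {t : ℝ} (ht : t ∈ Set.Icc 0 T) (p : M) :
    ‖ν p t‖ = 1 := by
  obtain ⟨K, -, hK⟩ := h.convex t ht
  exact hK.norm_eq_one p

/-- The set K need not contain its frontier, so the half-space condition is extended to its closure.
-/
theorem inner_normal_sub_nonpos (h : IsConvexSolution T F ν) {t : ℝ} (ht : t ∈ Set.Icc 0 T)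
    (p q : M) : inner ℝ (ν p t) (F q t - F p t) ≤ (0 : ℝ) := by
  obtain ⟨K, hb, hK⟩ := h.convex t ht
  have hq : F q t ∈ closure K := by
    have : F q t ∈ frontier K := by
      rw [hb.frontier_eq]
      exact ⟨q, rfl⟩
    exact frontier_subset_closure this
  have hcl : IsClosed {x | inner ℝ (ν p t) (x - F p t) ≤ (0 : ℝ)} :=
    isClosed_le (by fun_prop) continuous_const
  exact closure_minimal (fun x hx => hK.outward p x hx) hcl hq

theorem continuousAt_position (h : IsConvexSolution T F ν) (p : M) {t : ℝ}
    (ht : t ∈ Set.Ioo 0 T) : ContinuousAt (fun q : M × ℝ => F q.1 q.2) (p, t) :=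
  h.smooth.continuousOn.continuousAt (prod_mem_nhds Filter.univ_mem (Icc_mem_nhds ht.1 ht.2))

/-- An upper bound for the speed which is continuous in time extends to the final time. -/
theorem sq_div_norm_le_of_Ioo (h : IsConvexSolution T F ν) (hT : 0 < T) (p : M)
    (hne : ∀ t ∈ Set.Icc 0 T, F p t ≠ 0) {B : ℝ}
    (hB : ∀ t ∈ Set.Ioo 0 T, ((curvature F ν p t)⁻¹ / ‖F p t‖) ^ 2 ≤ B * (1 + 2 / t)) :
    ∀ t ∈ Set.Ioc 0 T, ((curvature F ν p t)⁻¹ / ‖F p t‖) ^ 2 ≤ B * (1 + 2 / t) := by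
  intro t ht
  rcases ht.2.lt_or_eq with hlt | rfl
  · exact hB t ⟨ht.1, hlt⟩
  have hF := contDiffOn_trajectory h.smooth p
  have hu : UniqueDiffOn ℝ (Set.Icc 0 t) := uniqueDiffOn_Icc hT
  -- The one-sided derivative of the trajectory is continuous up to the final time and has norm 1/H,
  -- so continuity of H in time needs no regularity of ν.
  have hd : ContinuousOn (derivWithin (fun s => F p s) (Set.Icc 0 t)) (Set.Icc 0 t) :=
    hF.continuousOn_derivWithin hu (by simp)
  have hspeed : ∀ s ∈ Set.Icc 0 t,
      ‖derivWithin (fun s => F p s) (Set.Icc 0 t) s‖ = (curvature F ν p s)⁻¹ := by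
    intro s hs
    rw [(h.flow s hs p).derivWithin (hu s hs), norm_smul, h.norm_normal hs, mul_one, norm_inv,
      Real.norm_of_nonneg (h.meanCurvature_pos s hs p).le]
  have htm : t ∈ Set.Icc 0 t := ⟨hT.le, le_rfl⟩
  have hsub : Set.Ioo 0 t ⊆ Set.Icc 0 t := Set.Ioo_subset_Icc_self
  have hlim : Filter.Tendsto (fun s => (‖derivWithin (fun s => F p s) (Set.Icc 0 t) s‖
      / ‖F p s‖) ^ 2) (nhdsWithin t (Set.Ioo 0 t)) (nhds (((curvature F ν p t)⁻¹
      / ‖F p t‖) ^ 2)) := by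
    rw [← hspeed t htm]
    exact ((((hd t htm).mono hsub).norm.div ((hF.continuousOn t htm).mono hsub).norm
      (norm_ne_zero_iff.2 (hne t htm))).pow 2).tendsto
  have hlim2 : Filter.Tendsto (fun s => B * (1 + 2 / s)) (nhdsWithin t (Set.Ioo 0 t))
      (nhds (B * (1 + 2 / t))) := by
    have : ContinuousAt (fun s => B * (1 + 2 / s)) t :=
      continuousAt_const.mul (continuousAt_const.add (continuousAt_const.div continuousAt_id hT.ne'))
    exact this.tendsto.mono_left nhdsWithin_le_nhds
  have hneBot : (nhdsWithin t (Set.Ioo 0 t)).NeBot := by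
    rw [← mem_closure_iff_nhdsWithin_neBot, closure_Ioo hT.ne]
    exact htm
  refine le_of_tendsto_of_tendsto hlim hlim2 ?_
  filter_upwards [self_mem_nhdsWithin] with s hs
  rw [hspeed s (hsub hs)]
  exact hB s hs

theorem isOpen_chartDomain (p : M) :
    IsOpen ((extChartAt (𝓡 n) p).target ×ˢ Set.Ioo 0 T) :=
  (isOpen_extChartAt_target p).prod isOpen_Ioo

theorem mem_chartDomain (p : M) {t : ℝ} (ht : t ∈ Set.Ioo 0 T) :
    (extChartAt (𝓡 n) p p, t) ∈ (extChartAt (𝓡 n) p).target ×ˢ Set.Ioo 0 T :=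
  ⟨mem_extChartAt_target p, ht⟩

variable [IsManifold (𝓡 n) ∞ M]

theorem contDiffOn_chart (h : IsConvexSolution T F ν) (p : M) :
    ContDiffOn ℝ ∞ (chartMap F p) ((extChartAt (𝓡 n) p).target ×ˢ Set.Ioo 0 T) :=
  (contDiffOn_chartMap h.smooth p).mono (Set.prod_mono le_rfl Set.Ioo_subset_Icc_self)

theorem dirDeriv_time (h : IsConvexSolution T F ν) (p : M)
    {y : EuclideanSpace ℝ (Fin n) × ℝ} (hy : y ∈ (extChartAt (𝓡 n) p).target ×ˢ Set.Ioo 0 T) :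
    dirDeriv (0, 1) (chartMap F p) y
      = (curvature F ν ((extChartAt (𝓡 n) p).symm y.1) y.2)⁻¹
        • ν ((extChartAt (𝓡 n) p).symm y.1) y.2 := by
  have hy2 : y.2 ∈ Set.Ioo 0 T := hy.2
  have h1 := (h.flow y.2 (Set.Ioo_subset_Icc_self hy2)
    ((extChartAt (𝓡 n) p).symm y.1)).hasDerivAt (Icc_mem_nhds hy2.1 hy2.2)
  have hd := differentiableAt_of_contDiffOn (isOpen_chartDomain p) (h.contDiffOn_chart p) hy
  have hc : HasDerivAt (fun s : ℝ => (y.1, s)) ((0 : EuclideanSpace ℝ (Fin n)), (1 : ℝ)) y.2 :=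
    (hasDerivAt_const _ _).prodMk (hasDerivAt_id _)
  have h2 : HasDerivAt (fun s : ℝ => chartMap F p (y.1, s)) (dirDeriv (0, 1) (chartMap F p) y) y.2 :=
    HasFDerivAt.comp_hasDerivAt (f := fun s : ℝ => (y.1, s)) y.2 hd.hasFDerivAt hc
  exact h2.unique h1

theorem norm_dirDeriv_time (h : IsConvexSolution T F ν) (p : M)
    {y : EuclideanSpace ℝ (Fin n) × ℝ} (hy : y ∈ (extChartAt (𝓡 n) p).target ×ˢ Set.Ioo 0 T) :
    ‖dirDeriv (0, 1) (chartMap F p) y‖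
      = (curvature F ν ((extChartAt (𝓡 n) p).symm y.1) y.2)⁻¹ := by
  have hy2 := Set.Ioo_subset_Icc_self hy.2
  rw [h.dirDeriv_time p hy, norm_smul, h.norm_normal hy2, mul_one, norm_inv, Real.norm_eq_abs,
    abs_of_pos (h.meanCurvature_pos _ hy2 _)]

theorem dirDeriv_time_ne_zero (h : IsConvexSolution T F ν) (p : M)
    {y : EuclideanSpace ℝ (Fin n) × ℝ} (hy : y ∈ (extChartAt (𝓡 n) p).target ×ˢ Set.Ioo 0 T) :
    dirDeriv (0, 1) (chartMap F p) y ≠ 0 := by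
  rw [← norm_ne_zero_iff, h.norm_dirDeriv_time p hy]
  exact inv_ne_zero (h.meanCurvature_pos _ (Set.Ioo_subset_Icc_self hy.2) _).ne'

theorem dirDeriv_space (h : IsConvexSolution T F ν) (p : M)
    {y : EuclideanSpace ℝ (Fin n) × ℝ} (hy : y ∈ (extChartAt (𝓡 n) p).target ×ˢ Set.Ioo 0 T)
    (v : EuclideanSpace ℝ (Fin n)) :
    dirDeriv (v, 0) (chartMap F p) y
      = fderiv ℝ ((fun q => F q y.2) ∘ (extChartAt (𝓡 n) p).symm) y.1 v := by
  have hd := differentiableAt_of_contDiffOn (isOpen_chartDomain p) (h.contDiffOn_chart p) hy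
  have hc : HasFDerivAt (fun x : EuclideanSpace ℝ (Fin n) => (x, y.2))
      (ContinuousLinearMap.inl ℝ (EuclideanSpace ℝ (Fin n)) ℝ) y.1 := hasFDerivAt_prodMk_left _ _
  have h2 : HasFDerivAt ((fun q => F q y.2) ∘ (extChartAt (𝓡 n) p).symm)
      ((fderiv ℝ (chartMap F p) y).comp (ContinuousLinearMap.inl ℝ _ ℝ)) y.1 :=
    HasFDerivAt.comp (f := fun x : EuclideanSpace ℝ (Fin n) => (x, y.2)) y.1 hd.hasFDerivAt hc
  rw [h2.fderiv]
  rfl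

/-- The relation is needed throughout the chart and not just at its centre, because it gets
differentiated in space and time. -/
theorem inner_dirDeriv_time_space (h : IsConvexSolution T F ν) (p : M)
    {y : EuclideanSpace ℝ (Fin n) × ℝ} (hy : y ∈ (extChartAt (𝓡 n) p).target ×ˢ Set.Ioo 0 T)
    (v : EuclideanSpace ℝ (Fin n)) :
    inner ℝ (dirDeriv (0, 1) (chartMap F p) y) (dirDeriv (v, 0) (chartMap F p) y) = (0 : ℝ) := by
  have hy2 := Set.Ioo_subset_Icc_self hy.2
  obtain ⟨K, -, hK⟩ := h.convex y.2 hy2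
  obtain ⟨c, hc⟩ := fderiv_comp_extChartAt_symm (contMDiff_slice h.smooth hy2) p hy.1 v
  rw [h.dirDeriv_time p hy, h.dirDeriv_space p hy, hc, inner_smul_left, inner_sum]
  simp [inner_smul_right, hK.orthogonal]

/-- The coordinate directions in space-time. -/
noncomputable abbrev coordDir (n : ℕ) (i : Fin n) : EuclideanSpace ℝ (Fin n) × ℝ :=
  (EuclideanSpace.single i (1 : ℝ), 0)

theorem mem_span_coordDir {v : EuclideanSpace ℝ (Fin n) × ℝ}
    (hv : v ∈ Submodule.span ℝ (Set.range (coordDir n))) : v = (v.1, 0) := by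
  have hle : Submodule.span ℝ (Set.range (coordDir n))
      ≤ LinearMap.ker (LinearMap.snd ℝ (EuclideanSpace ℝ (Fin n)) ℝ) := by
    rw [Submodule.span_le]
    rintro _ ⟨i, rfl⟩
    simp
  have : v.2 = 0 := by simpa using hle hv
  ext1
  · rfl
  · exact this

theorem partialDeriv_eq (h : IsConvexSolution T F ν) (p : M) {t : ℝ} (ht : t ∈ Set.Ioo 0 T)
    (i : Fin n) : partialDeriv (fun q => F q t) p i
      = dirDeriv (coordDir n i) (chartMap F p) (extChartAt (𝓡 n) p p, t) := by
  have hd : DifferentiableAt ℝ ((fun q => F q t) ∘ (extChartAt (𝓡 n) p).symm)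
      (extChartAt (𝓡 n) p p) := by
    have hd := differentiableAt_of_contDiffOn (isOpen_chartDomain p) (h.contDiffOn_chart p)
      (mem_chartDomain p ht)
    exact DifferentiableAt.comp (f := fun x : EuclideanSpace ℝ (Fin n) => (x, t))
      (extChartAt (𝓡 n) p p) hd (by fun_prop)
  rw [h.dirDeriv_space p (mem_chartDomain p ht), partialDeriv,
    mfderiv_eq_fderiv_of_chart (fun x _ => rfl) hd]
  rfl

/-- Locally ν = V/|V|, which is also what makes ν differentiable. The derivative of the factor 1/|V|
contributes a multiple of V, which is orthogonal to the tangent vectors, and 1/|V| = H. -/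
theorem inner_partialDeriv_normal (h : IsConvexSolution T F ν) (p : M) {t : ℝ}
    (ht : t ∈ Set.Ioo 0 T) (i j : Fin n) :
    inner ℝ (partialDeriv (fun q => ν q t) p i) (partialDeriv (fun q => F q t) p j)
      = curvature F ν p t * velocityMatrix (0, 1) (coordDir n) (chartMap F p)
        (extChartAt (𝓡 n) p p, t) i j := by
  have hm := mem_chartDomain (n := n) (T := T) p ht
  have hΩ := isOpen_chartDomain (n := n) (T := T) p
  have hV := contDiffOn_dirDeriv hΩ (h.contDiffOn_chart p) (0, 1)
  set V := dirDeriv (0, 1) (chartMap F p) with hVdef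
  set z := (extChartAt (𝓡 n) p p, t) with hz
  let N : EuclideanSpace ℝ (Fin n) → EuclideanSpace ℝ (Fin (n + 1)) :=
    fun x => ‖V (x, t)‖⁻¹ • V (x, t)
  have hN : ∀ x ∈ (extChartAt (𝓡 n) p).target, ν ((extChartAt (𝓡 n) p).symm x) t = N x := by
    intro x hx
    have hxm : (x, t) ∈ (extChartAt (𝓡 n) p).target ×ˢ Set.Ioo 0 T := ⟨hx, ht⟩
    simp only [N, hVdef]
    rw [h.norm_dirDeriv_time p hxm, h.dirDeriv_time p hxm, inv_inv, smul_smul,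
      mul_inv_cancel₀ (h.meanCurvature_pos _ (Set.Ioo_subset_Icc_self ht) _).ne', one_smul]
  have hVz : V z ≠ 0 := h.dirDeriv_time_ne_zero p hm
  have hdV : DifferentiableAt ℝ V z := differentiableAt_of_contDiffOn hΩ hV hm
  have hc : HasFDerivAt (fun x : EuclideanSpace ℝ (Fin n) => (x, t))
      (ContinuousLinearMap.inl ℝ (EuclideanSpace ℝ (Fin n)) ℝ) (extChartAt (𝓡 n) p p) :=
    hasFDerivAt_prodMk_left _ _
  have hVx : HasFDerivAt (fun x => V (x, t)) ((fderiv ℝ V z).comp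
      (ContinuousLinearMap.inl ℝ _ ℝ)) (extChartAt (𝓡 n) p p) :=
    HasFDerivAt.comp (f := fun x : EuclideanSpace ℝ (Fin n) => (x, t)) _ hdV.hasFDerivAt hc
  have hnorm : DifferentiableAt ℝ (fun x => ‖V (x, t)‖⁻¹) (extChartAt (𝓡 n) p p) :=
    (hVx.differentiableAt.norm ℝ hVz).inv (norm_ne_zero_iff.2 hVz)
  have hNd : HasFDerivAt N _ (extChartAt (𝓡 n) p p) := hnorm.hasFDerivAt.smul hVx
  have hpd : partialDeriv (fun q => ν q t) p i
      = fderiv ℝ N (extChartAt (𝓡 n) p p) (EuclideanSpace.single i (1 : ℝ)) := by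
    rw [partialDeriv, mfderiv_eq_fderiv_of_chart hN hNd.differentiableAt]
    rfl
  rw [h.partialDeriv_eq p ht j, hpd, hNd.fderiv]
  have horth : inner ℝ (V z) (dirDeriv (coordDir n j) (chartMap F p) z) = (0 : ℝ) :=
    h.inner_dirDeriv_time_space p hm _
  have hcurv : ‖V z‖⁻¹ = curvature F ν p t := by
    rw [h.norm_dirDeriv_time p hm, inv_inv]
    simp [hz]
  rw [← hcurv]
  simp only [add_apply, smul_apply,
    ContinuousLinearMap.smulRight_apply, inner_add_left, inner_smul_left]
  rw [← hz, horth, mul_zero, add_zero]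
  rfl

/-- Substituting h = Hk into H = tr(g⁻¹h) and cancelling H > 0. In this form the flow equation no
longer mentions ν or H. -/
theorem trace_inv_metricMatrix_mul (h : IsConvexSolution T F ν) (p : M) {t : ℝ}
    (ht : t ∈ Set.Ioo 0 T) :
    ((metricMatrix (coordDir n) (chartMap F p) (extChartAt (𝓡 n) p p, t))⁻¹
      * velocityMatrix (0, 1) (coordDir n) (chartMap F p) (extChartAt (𝓡 n) p p, t)).trace = 1 := by
  have h1 : firstForm (fun q => F q t) p
      = metricMatrix (coordDir n) (chartMap F p) (extChartAt (𝓡 n) p p, t) := by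
    ext i j
    simp only [firstForm, metricMatrix, Matrix.of_apply, h.partialDeriv_eq p ht]
  have h2 : secondForm (fun q => F q t) (fun q => ν q t) p = curvature F ν p t
      • velocityMatrix (0, 1) (coordDir n) (chartMap F p) (extChartAt (𝓡 n) p p, t) := by
    ext i j
    simp only [secondForm, Matrix.of_apply, h.inner_partialDeriv_normal p ht, Matrix.smul_apply,
      smul_eq_mul]
  have hpos := h.meanCurvature_pos t (Set.Ioo_subset_Icc_self ht) p
  have h3 : curvature F ν p t = curvature F ν p t
      * ((metricMatrix (coordDir n) (chartMap F p) (extChartAt (𝓡 n) p p, t))⁻¹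
      * velocityMatrix (0, 1) (coordDir n) (chartMap F p)
        (extChartAt (𝓡 n) p p, t)).trace := by
    conv_lhs => rw [curvature, meanCurvature, h1, h2, Matrix.mul_smul, Matrix.trace_smul,
      smul_eq_mul]
  exact (mul_left_cancel₀ hpos.ne' (by rw [mul_one]; exact h3)).symm

end IsConvexSolution

end Solution

/-! ### Size of the comparison function and of its gradient on the cone. -/

section Cone

variable {G : Type*} [NormedAddCommGroup G] [InnerProductSpace ℝ G] {e x : G} {ε : ℝ}

theorem mul_norm_le_coneFunction (hx : 2 * ε * ‖x‖ ≤ inner ℝ x e) :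
    ε * ‖x‖ ≤ coneFunction e ε x := by
  rw [coneFunction]
  linarith

theorem coneFunction_le_norm (hε : 0 ≤ ε) (he : ‖e‖ = 1) : coneFunction e ε x ≤ ‖x‖ := by
  have h1 := real_inner_le_norm x e
  have h2 : 0 ≤ ε * ‖x‖ := by positivity
  rw [he, mul_one] at h1
  rw [coneFunction]
  linarith

theorem norm_gradient_coneFunction_le (hε : 0 ≤ ε) (hε1 : ε ≤ 1) (he : ‖e‖ = 1) (hx : x ≠ 0) :
    ‖e - (ε / ‖x‖) • x‖ ≤ 2 := by
  have hx' : ‖x‖ ≠ 0 := norm_ne_zero_iff.2 hx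
  calc ‖e - (ε / ‖x‖) • x‖ ≤ ‖e‖ + ‖(ε / ‖x‖) • x‖ := norm_sub_le _ _
    _ = 1 + ε := by
        rw [he, norm_smul, Real.norm_of_nonneg (by positivity), div_mul_cancel₀ _ hx']
    _ ≤ 2 := by linarith

end Cone

/-- The maximum in time may sit at the right end of the time interval, so only earlier times can be
compared and only a sign results. -/
theorem deriv_nonneg_of_le_left {l : ℝ → ℝ} {l' a b : ℝ} (hl : HasDerivAt l l' b) (hab : a < b)
    (hmax : ∀ s ∈ Set.Ioc a b, l s ≤ l b) : 0 ≤ l' := by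
  set c := (a + b) / 2 with hc
  have hcb : c < b := by linarith
  have hac : a < c := by linarith
  have hm : IsMaxOn l (Set.Icc c b) b := fun s hs => hmax s ⟨hac.trans_le hs.1, hs.2⟩
  have hcone : c - b ∈ posTangentConeAt (Set.Icc c b) b :=
    sub_mem_posTangentConeAt_of_segment_subset (by
      rw [segment_symm, segment_eq_Icc hcb.le])
  have := hm.localize.hasFDerivWithinAt_nonpos hl.hasFDerivAt.hasFDerivWithinAt hcone
  simp at this
  nlinarith

/-! ### The maximum principle. -/

section Bound

variable {n : ℕ} {M : Type*} [TopologicalSpace M] [ChartedSpace (EuclideanSpace ℝ (Fin n)) M]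
  [IsManifold (𝓡 n) ∞ M] {T : ℝ} {F ν : M → ℝ → EuclideanSpace ℝ (Fin (n + 1))}
  {e : EuclideanSpace ℝ (Fin (n + 1))} {ε : ℝ}

namespace IsConvexSolution

/-- An immersed hypersurface inside a cone avoids the vertex. -/
theorem position_ne_zero (h : IsConvexSolution T F ν) (hn : 0 < n) (hε : 0 < ε) {t : ℝ}
    (ht : t ∈ Set.Icc 0 T) (hcone : ∀ q, 2 * ε * ‖F q t‖ ≤ inner ℝ (F q t) e) (p : M) :
    F p t ≠ 0 := by
  intro hp
  set N : EuclideanSpace ℝ (Fin n) → EuclideanSpace ℝ (Fin (n + 1)) :=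
    (fun q => F q t) ∘ (extChartAt (𝓡 n) p).symm with hN
  set x := extChartAt (𝓡 n) p p with hx
  have hNd : DifferentiableAt ℝ N x := by
    rw [← mdifferentiableAt_iff_differentiableAt]
    have h1 : MDifferentiableAt 𝓘(ℝ, EuclideanSpace ℝ (Fin n)) (𝓡 n)
        (extChartAt (𝓡 n) p).symm x :=
      ((contMDiffOn_extChartAt_symm (n := ∞) p).contMDiffAt
        (extChartAt_target_mem_nhds p)).mdifferentiableAt (by simp)
    exact ((contMDiff_slice h.smooth ht).mdifferentiableAt (by simp)).comp x h1
  have hN0 : N x = 0 := by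
    simp [hN, hx, hp]
  have hinj : Function.Injective (fderiv ℝ N x) := by
    have := h.immersion t ht p
    rw [mfderiv_eq_fderiv_of_chart (fun y _ => rfl) hNd] at this
    exact this
  set v : EuclideanSpace ℝ (Fin n) := EuclideanSpace.single ⟨0, hn⟩ 1 with hv
  set a := fderiv ℝ N x v with ha
  have ha0 : a ≠ 0 := by
    intro h0
    have h1 : v = 0 := hinj (by rw [← ha, h0, map_zero])
    have h2 : ‖v‖ = 1 := by simp [hv]
    rw [h1, norm_zero] at h2
    exact zero_ne_one h2
  -- A linear function that is non-negative on the hypersurface attains its minimum at p, where F =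
  -- 0, so it vanishes on the tangent vector a.
  have key : ∀ c, (∀ q, 0 ≤ inner ℝ (F q t) c) → inner ℝ a c = (0 : ℝ) := by
    intro c hc
    have hmin : IsLocalMin (fun y => inner ℝ (N y) c) x := by
      refine Filter.Eventually.of_forall fun y => ?_
      simp only [hN0, inner_zero_left]
      exact hc _
    have h1 := hmin.fderiv_eq_zero
    have h2 := fderiv_inner_apply ℝ hNd (differentiableAt_const c) v
    rw [h1] at h2
    simpa using h2.symm
  have h1 := key e fun q => le_trans (by positivity) (hcone q)
  -- The cone condition and Cauchy–Schwarz make this second functional non-negative too. As a is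
  -- orthogonal to e, it takes the value -2ε‖a‖² at a, which must therefore vanish.
  have h2 := key (‖a‖ • e - (2 * ε) • a) fun q => by
    rw [inner_sub_right, inner_smul_right, inner_smul_right]
    have h3 := real_inner_le_norm (F q t) a
    have h4 := mul_le_mul_of_nonneg_left (hcone q) (norm_nonneg a)
    have h5 := mul_le_mul_of_nonneg_left h3 (by positivity : 0 ≤ 2 * ε)
    linarith
  rw [inner_sub_right, inner_smul_right, inner_smul_right, h1, real_inner_self_eq_norm_sq] at h2
  have h6 : 0 < 2 * ε * ‖a‖ ^ 2 := by
    have := norm_pos_iff.2 ha0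
    positivity
  linarith

/-- Near p, 1/H is the norm of the time derivative of F in one fixed chart, so joint continuity
comes from the smoothness of F. -/
theorem continuousAt_inv_curvature (h : IsConvexSolution T F ν) (p : M) {t : ℝ}
    (ht : t ∈ Set.Ioo 0 T) :
    ContinuousAt (fun q : M × ℝ => (curvature F ν q.1 q.2)⁻¹) (p, t) := by
  have hV : ContinuousAt (dirDeriv (0, 1) (chartMap F p)) (extChartAt (𝓡 n) p p, t) :=
    (differentiableAt_of_contDiffOn (isOpen_chartDomain p)
      (contDiffOn_dirDeriv (isOpen_chartDomain p) (h.contDiffOn_chart p) (0, 1))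
      (mem_chartDomain p ht)).continuousAt
  have hχ : ContinuousAt (fun q : M × ℝ => (extChartAt (𝓡 n) p q.1, q.2)) (p, t) :=
    ((continuousAt_extChartAt (I := 𝓡 n) p).comp (x := (p, t)) continuousAt_fst).prodMk
      continuousAt_snd
  have hc := (ContinuousAt.comp (x := (p, t)) (g := dirDeriv (0, 1) (chartMap F p))
    (f := fun q : M × ℝ => (extChartAt (𝓡 n) p q.1, q.2)) hV hχ).norm
  refine hc.congr ?_
  filter_upwards [prod_mem_nhds (extChartAt_source_mem_nhds (I := 𝓡 n) p)
    (Ioo_mem_nhds ht.1 ht.2)] with q hq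
  have hm : (extChartAt (𝓡 n) p q.1, q.2) ∈ (extChartAt (𝓡 n) p).target ×ˢ Set.Ioo 0 T :=
    ⟨(extChartAt (𝓡 n) p).map_source hq.1, hq.2⟩
  rw [Function.comp_apply, h.norm_dirDeriv_time p hm]
  simp only [(extChartAt (𝓡 n) p).left_inv hq.1]

/-- The estimate at a point where `(1 / (H φ(F)))² (s - t₁) / (1 + s - t₁)` is maximal. -/
theorem bound_of_isMax (h : IsConvexSolution T F ν) (hn : 2 ≤ n) (hε : 0 < ε) (hε1 : ε ≤ 1)
    (he : ‖e‖ = 1) (hcone : ∀ t ∈ Set.Icc 0 T, ∀ q, 2 * ε * ‖F q t‖ ≤ inner ℝ (F q t) e)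
    {p : M} {t₁ t : ℝ} (ht : t ∈ Set.Ioo 0 T) (ht₁ : 0 ≤ t₁) (htt : t₁ < t)
    (hspace : ∀ q, (curvature F ν q t)⁻¹ / coneFunction e ε (F q t)
      ≤ (curvature F ν p t)⁻¹ / coneFunction e ε (F p t))
    (htime : ∀ s ∈ Set.Ioc t₁ t,
      ((curvature F ν p s)⁻¹ / coneFunction e ε (F p s)) ^ 2 * ((s - t₁) / (1 + (s - t₁)))
      ≤ ((curvature F ν p t)⁻¹ / coneFunction e ε (F p t)) ^ 2 * ((t - t₁) / (1 + (t - t₁)))) :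
    ((curvature F ν p t)⁻¹ / coneFunction e ε (F p t)) ^ 2 * ((t - t₁) / (1 + (t - t₁)))
      ≤ 2 / ε ^ 2 * (3 / 2 + 8 / ε ^ 2) := by
  have hΩ := isOpen_chartDomain (n := n) (T := T) p
  have hf := h.contDiffOn_chart p
  have hz := mem_chartDomain (n := n) (T := T) p ht
  have hV := contDiffOn_dirDeriv hΩ hf (0, 1)
  have hne : ∀ s ∈ Set.Icc 0 T, ∀ q, F q s ≠ 0 := fun s hs q =>
    h.position_ne_zero (by omega) hε hs (hcone s hs) q
  have hφpos : ∀ s ∈ Set.Icc 0 T, ∀ q, 0 < coneFunction e ε (F q s) := fun s hs q =>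
    lt_of_lt_of_le (mul_pos hε (norm_pos_iff.2 (hne s hs q)))
      (mul_norm_le_coneFunction (hcone s hs q))
  have hHpos : ∀ s ∈ Set.Icc 0 T, ∀ q, 0 < (curvature F ν q s)⁻¹ := fun s hs q =>
    inv_pos.2 (h.meanCurvature_pos s hs q)
  have htI := Set.Ioo_subset_Icc_self ht
  set f := chartMap F p with hfdef
  set z := (extChartAt (𝓡 n) p p, t) with hzdef
  set V := dirDeriv (0, 1) f with hVdef
  have h0 : ∀ y ∈ (extChartAt (𝓡 n) p).target ×ˢ Set.Ioo 0 T, f y ≠ 0 := fun y hy =>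
    hne _ (Set.Ioo_subset_Icc_self hy.2) _
  have hfz : ∀ s, f (extChartAt (𝓡 n) p p, s) = F p s := fun s =>
    chartMap_extChartAt F (mem_extChartAt_source p) s
  have hVz : ∀ s ∈ Set.Ioo 0 T, ‖V (extChartAt (𝓡 n) p p, s)‖ = (curvature F ν p s)⁻¹ := by
    intro s hs
    rw [h.norm_dirDeriv_time p (mem_chartDomain p hs)]
    simp only [extChartAt_to_inv]
  set φ := coneFunction e ε (f z) with hφdef
  have hφF : φ = coneFunction e ε (F p t) := by rw [hφdef, hzdef, hfz]
  rw [← hφF] at hspace htime ⊢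
  rw [← hVz t ht] at hspace htime ⊢
  rw [← hzdef] at hspace htime ⊢
  set w := ‖V z‖ / φ with hwdef
  have hφ0 : 0 < φ := hφF ▸ hφpos t htI p
  have hV0 : V z ≠ 0 := h.dirDeriv_time_ne_zero p hz
  have hw0 : 0 < w := div_pos (norm_pos_iff.2 hV0) hφ0
  have hw : ‖V z‖ = w * φ := (div_mul_cancel₀ _ hφ0.ne').symm
  have hline : ∀ v ∈ Submodule.span ℝ (Set.range (coordDir n)), ∀ᶠ s : ℝ in nhds 0,
      (z + s • v) ∈ (extChartAt (𝓡 n) p).target ×ˢ Set.Ioo 0 T ∧ (z + s • v).2 = t := by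
    intro v hv
    filter_upwards [eventually_line_mem hΩ hz v] with s hs
    refine ⟨hs, ?_⟩
    rw [mem_span_coordDir hv]
    simp [hzdef]
  have hineq := deriv_log_speed_le_of_coordinates hΩ hf (by simp) (c := coordDir n) (τ := (0, 1))
    (z := z) (w := w) (e := e) (ε := ε)
    (fun y hy v hv => by
      rw [mem_span_coordDir hv]
      exact h.inner_dirDeriv_time_space p hy _) hz
    (by
      filter_upwards [eventually_line_mem hΩ hz (0, 1)] with s hs
      -- Moving in time stays at the chart centre, the only place where the coordinate form of the
      -- trace identity is available.
      have hs' : z + s • ((0 : EuclideanSpace ℝ (Fin n)), (1 : ℝ))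
          = (extChartAt (𝓡 n) p p, t + s) := by
        simp [hzdef]
      rw [hs'] at hs ⊢
      exact h.trace_inv_metricMatrix_mul p hs.2)
    (fun v hv => by
      filter_upwards [hline v hv] with s hs
      have h1 := h.inner_normal_sub_nonpos htI p ((extChartAt (𝓡 n) p).symm (z + s • v).1)
      have h2 : f (z + s • v) = F ((extChartAt (𝓡 n) p).symm (z + s • v).1) t := by
        rw [hfdef, chartMap, hs.2]
      have h3 : V z = (curvature F ν p t)⁻¹ • ν p t := by
        rw [hVdef, h.dirDeriv_time p hz]
        simp only [hzdef, extChartAt_to_inv]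
      rw [← hVdef, h2, h3, inner_smul_left, hzdef, hfz]
      exact mul_nonpos_of_nonneg_of_nonpos (hHpos t htI p).le h1)
    h0 hV0 hε.le hφ0 hw
    (fun v hv => by
      filter_upwards [hline v hv] with s hs
      have h1 := hspace ((extChartAt (𝓡 n) p).symm (z + s • v).1)
      have h2 : f (z + s • v) = F ((extChartAt (𝓡 n) p).symm (z + s • v).1) t := by
        rw [hfdef, chartMap, hs.2]
      have h3 : ‖V (z + s • v)‖ = (curvature F ν ((extChartAt (𝓡 n) p).symm (z + s • v).1) t)⁻¹ := by
        rw [hVdef, h.norm_dirDeriv_time p hs.1, hs.2]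
      rw [← hVdef, h2, h3, ← mul_pow]
      rw [div_le_iff₀ (hφpos t htI _)] at h1
      exact pow_le_pow_left₀ (hHpos t htI _).le h1 2)
  rw [← hφdef, ← hVdef] at hineq
  have hσ : 0 < t - t₁ := by linarith
  have hr : 0 < ‖f z‖ := norm_pos_iff.2 (h0 z hz)
  -- the time derivative
  have hcl : ∀ {Y : Type} [NormedAddCommGroup Y] [NormedSpace ℝ Y]
      (g : EuclideanSpace ℝ (Fin n) × ℝ → Y),
      ContDiffOn ℝ ∞ g ((extChartAt (𝓡 n) p).target ×ˢ Set.Ioo 0 T) →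
      HasDerivAt (fun s => g (extChartAt (𝓡 n) p p, s)) (dirDeriv (0, 1) g z) t := by
    intro Y _ _ g hg
    have hc : HasDerivAt (fun s : ℝ => (extChartAt (𝓡 n) p p, s))
        ((0 : EuclideanSpace ℝ (Fin n)), (1 : ℝ)) t :=
      (hasDerivAt_const _ _).prodMk (hasDerivAt_id _)
    exact HasFDerivAt.comp_hasDerivAt (f := fun s : ℝ => (extChartAt (𝓡 n) p p, s)) t
      (differentiableAt_of_contDiffOn hΩ hg hz).hasFDerivAt hc
  -- The logarithm of w² σ/(1+σ) is differentiated term by term; log ⟨V, V⟩ is twice the logarithm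
  -- of the speed, whence the factor 2 on log φ.
  have hd1 := (hcl _ (hV.inner ℝ hV)).log (by
    rw [real_inner_self_eq_norm_sq]
    exact pow_ne_zero _ (norm_ne_zero_iff.2 hV0))
  have hd2 := (hcl _ (contDiffOn_coneFunction e ε hf h0)).log hφ0.ne'
  have hd3 := ((hasDerivAt_id t).sub_const t₁).log hσ.ne'
  have hd4 := (((hasDerivAt_id t).sub_const t₁).const_add 1).log
    (by simp only [id]; positivity : 1 + (id t - t₁) ≠ 0)
  have hd := ((hd1.sub (hd2.const_mul 2)).add hd3).sub hd4
  rw [dirDeriv_inner hΩ hV hV hz, dirDeriv_coneFunction_eq_inner hΩ e ε hf h0 hz] at hd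
  have hnonneg := deriv_nonneg_of_le_left hd htt (by
    have hlog : ∀ s ∈ Set.Ioc t₁ t, Real.log (inner ℝ (V (extChartAt (𝓡 n) p p, s))
        (V (extChartAt (𝓡 n) p p, s)))
        - 2 * Real.log (coneFunction e ε (f (extChartAt (𝓡 n) p p, s)))
        + Real.log (s - t₁) - Real.log (1 + (s - t₁))
        = Real.log (((curvature F ν p s)⁻¹ / coneFunction e ε (F p s)) ^ 2
          * ((s - t₁) / (1 + (s - t₁)))) ∧ 0 < ((curvature F ν p s)⁻¹ / coneFunction e ε (F p s)) ^ 2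
          * ((s - t₁) / (1 + (s - t₁))) := by
      intro s hs
      have hsI : s ∈ Set.Ioo 0 T := ⟨ht₁.trans_lt hs.1, hs.2.trans_lt ht.2⟩
      have ha := hHpos s (Set.Ioo_subset_Icc_self hsI) p
      have hb := hφpos s (Set.Ioo_subset_Icc_self hsI) p
      have hc : 0 < s - t₁ := by linarith [hs.1]
      refine ⟨?_, by positivity⟩
      rw [real_inner_self_eq_norm_sq, hVz s hsI, hfz, Real.log_mul (by positivity) (by positivity),
        Real.log_div (by positivity) (by positivity), Real.log_pow, Real.log_pow,
        Real.log_div ha.ne' hb.ne']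
      push_cast
      ring
    intro s hs
    have hss := hlog s hs
    have htt' := hlog t ⟨htt, le_rfl⟩
    change _ - 2 * _ + Real.log (s - t₁) - Real.log (1 + (s - t₁))
      ≤ _ - 2 * _ + Real.log (t - t₁) - Real.log (1 + (t - t₁))
    refine (hss.1.trans_le (Real.log_le_log hss.2 ?_)).trans_eq htt'.1.symm
    rw [← hVz t ht, ← hφF]
    exact htime s hs)
  rw [real_inner_comm (dirDeriv (0, 1) V z) (V z), real_inner_self_eq_norm_sq] at hnonneg
  refine sq_mul_le_of_maximum (r := ‖f z‖) (β := φ) (m := (n : ℝ) - 1) hε hw0 hσ hr ?_ ?_ ?_ hineq ?_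
  · have : (2 : ℝ) ≤ n := by exact_mod_cast hn
    linarith
  · rw [hφF, hzdef, hfz]
    exact mul_norm_le_coneFunction (hcone t htI p)
  · rw [abs_div, abs_of_pos hφ0, div_le_iff₀ hφ0]
    calc |inner ℝ (V z) (e - (ε / ‖f z‖) • f z)| ≤ ‖V z‖ * ‖e - (ε / ‖f z‖) • f z‖ :=
          abs_real_inner_le_norm _ _
      _ ≤ ‖V z‖ * 2 := mul_le_mul_of_nonneg_left
          (norm_gradient_coneFunction_le hε.le hε1 he (h0 z hz)) (norm_nonneg _)
      _ = 2 * w * φ := by rw [hw]; ring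
  · refine hnonneg.trans_eq ?_
    simp only [id]
    ring

/-- The estimate at interior times. -/
theorem sq_div_norm_le [CompactSpace M] (h : IsConvexSolution T F ν) (hn : 2 ≤ n) (hε : 0 < ε)
    (hε1 : ε ≤ 1) (he : ‖e‖ = 1)
    (hcone : ∀ t ∈ Set.Icc 0 T, ∀ q, 2 * ε * ‖F q t‖ ≤ inner ℝ (F q t) e)
    {t : ℝ} (ht : t ∈ Set.Ioo 0 T) (p : M) :
    ((curvature F ν p t)⁻¹ / ‖F p t‖) ^ 2
      ≤ 2 / ε ^ 2 * (3 / 2 + 8 / ε ^ 2) * (1 + 2 / t) := by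
  have ht0 : 0 < t := ht.1
  have hne : ∀ s ∈ Set.Icc 0 T, ∀ q, F q s ≠ 0 := fun s hs q =>
    h.position_ne_zero (by omega) hε hs (hcone s hs) q
  have hφpos : ∀ s ∈ Set.Icc 0 T, ∀ q, 0 < coneFunction e ε (F q s) := fun s hs q =>
    lt_of_lt_of_le (mul_pos hε (norm_pos_iff.2 (hne s hs q)))
      (mul_norm_le_coneFunction (hcone s hs q))
  have hHpos : ∀ s ∈ Set.Icc 0 T, ∀ q, 0 < (curvature F ν q s)⁻¹ := fun s hs q =>
    inv_pos.2 (h.meanCurvature_pos s hs q)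
  -- Starting the clock at t/2 instead of 0 keeps all times in the open interval, where time
  -- derivatives are two-sided. At time t the weight is t/(2 + t), which produces the factor 1 +
  -- 2/t.
  let y : M × ℝ → ℝ := fun q => ((curvature F ν q.1 q.2)⁻¹ / coneFunction e ε (F q.1 q.2)) ^ 2
    * ((q.2 - t / 2) / (1 + (q.2 - t / 2)))
  have hIcc : ∀ s ∈ Set.Icc (t / 2) t, s ∈ Set.Ioo 0 T := fun s hs =>
    ⟨lt_of_lt_of_le (by linarith) hs.1, hs.2.trans_lt ht.2⟩
  have hcont : ContinuousOn y (Set.univ ×ˢ Set.Icc (t / 2) t) := by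
    rintro ⟨q, s⟩ ⟨-, hs⟩
    have hs' := hIcc s hs
    have hF := h.continuousAt_position q hs'
    have hφ : ContinuousAt (fun r : M × ℝ => coneFunction e ε (F r.1 r.2)) (q, s) :=
      (hF.inner continuousAt_const).sub (continuousAt_const.mul hF.norm)
    have hs2 : ContinuousAt (fun r : M × ℝ => r.2 - t / 2) (q, s) :=
      continuousAt_snd.sub continuousAt_const
    have hs0 : 1 + (s - t / 2) ≠ 0 := by
      have := hs.1
      linarith
    exact ((((h.continuousAt_inv_curvature q hs').div hφ
      (hφpos s (Set.Ioo_subset_Icc_self hs') q).ne').pow 2).mul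
      (hs2.div (continuousAt_const.add hs2) hs0)).continuousWithinAt
  obtain ⟨⟨p₀, t₀⟩, ⟨-, ht₀⟩, hmax⟩ := (isCompact_univ.prod isCompact_Icc).exists_isMaxOn
    ⟨(p, t), Set.mem_univ _, by constructor <;> linarith⟩ hcont
  have hle : ∀ q, ∀ s ∈ Set.Icc (t / 2) t, y (q, s) ≤ y (p₀, t₀) := fun q s hs =>
    hmax (show (q, s) ∈ Set.univ ×ˢ Set.Icc (t / 2) t from ⟨Set.mem_univ _, hs⟩)
  have htI := Set.Ioo_subset_Icc_self ht
  have hyt : y (p, t) = ((curvature F ν p t)⁻¹ / coneFunction e ε (F p t)) ^ 2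
      * (t / (2 + t)) := by
    have : (t - t / 2) / (1 + (t - t / 2)) = t / (2 + t) := by
      rw [div_eq_div_iff (by linarith) (by linarith)]
      ring
    simp only [y, this]
  have hypos : 0 < y (p, t) := by
    have h1 := hHpos t htI p
    have h2 := hφpos t htI p
    rw [hyt]
    positivity
  have hpt := hle p t ⟨by linarith, le_rfl⟩
  -- The weight vanishes at the initial time while y is positive at (p, t), so the maximum is not
  -- attained there.
  have ht₀' : t / 2 < t₀ := by
    rcases ht₀.1.eq_or_lt with h1 | h1
    · have hz : t₀ - t / 2 = 0 := sub_eq_zero.2 h1.symm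
      have : y (p₀, t₀) = 0 := by simp [y, hz]
      linarith
    · exact h1
  have hσ : 0 < (t₀ - t / 2) / (1 + (t₀ - t / 2)) := by
    have : 0 < t₀ - t / 2 := by linarith
    positivity
  have ht₀I := Set.Ioo_subset_Icc_self (hIcc t₀ ht₀)
  have hbound := h.bound_of_isMax hn hε hε1 he hcone (p := p₀) (hIcc t₀ ht₀)
    (by linarith : 0 ≤ t / 2) ht₀'
    (fun q => by
      have h1 := le_of_mul_le_mul_right (hle q t₀ ht₀) hσ
      exact le_of_sq_le_sq h1 (div_pos (hHpos t₀ ht₀I p₀) (hφpos t₀ ht₀I p₀)).le)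
    (fun s hs => hle p₀ s ⟨hs.1.le, hs.2.trans ht₀.2⟩)
  have hfin := hpt.trans hbound
  rw [hyt, mul_div_assoc', div_le_iff₀ (by linarith)] at hfin
  have hnorm : (curvature F ν p t)⁻¹ / ‖F p t‖
      ≤ (curvature F ν p t)⁻¹ / coneFunction e ε (F p t) :=
    div_le_div_of_nonneg_left (hHpos t htI p).le (hφpos t htI p) (coneFunction_le_norm hε.le he)
  have hnorm0 : 0 ≤ (curvature F ν p t)⁻¹ / ‖F p t‖ :=
    div_nonneg (hHpos t htI p).le (norm_nonneg _)
  calc ((curvature F ν p t)⁻¹ / ‖F p t‖) ^ 2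
      ≤ ((curvature F ν p t)⁻¹ / coneFunction e ε (F p t)) ^ 2 :=
        pow_le_pow_left₀ hnorm0 hnorm 2
    _ ≤ 2 / ε ^ 2 * (3 / 2 + 8 / ε ^ 2) * (2 + t) / t := by rwa [le_div_iff₀ ht0]
    _ = 2 / ε ^ 2 * (3 / 2 + 8 / ε ^ 2) * (1 + 2 / t) := by
        field_simp
        ring

end IsConvexSolution

end Bound

end IMCF

/-! ### The theorem. -/

theorem mainTheorem3 (θ₁ : ℝ) (hθ₁ : θ₁ ∈ Set.Ioo 0 (Real.pi / 2)) :
    ∃ C : ℝ, 0 < C ∧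
      ∀ (n : ℕ), 2 ≤ n →
      ∀ (M : Type*) [TopologicalSpace M] [T2Space M] [CompactSpace M]
        [ChartedSpace (EuclideanSpace ℝ (Fin n)) M] [IsManifold (𝓡 n) ∞ M]
        (T : ℝ), 0 < T →
      ∀ (F ν : M → ℝ → EuclideanSpace ℝ (Fin (n + 1))),
        IMCF.IsConvexSolution T F ν →
        (∀ t ∈ Set.Icc 0 T, ∀ p,
          Real.sin θ₁ * ‖F p t‖ ≤ inner ℝ (F p t) (EuclideanSpace.single (Fin.last n) (1 : ℝ))) →
        ∀ t ∈ Set.Ioc 0 T, ∀ p,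
          F p t ≠ 0 ∧
          1 / (IMCF.meanCurvature (fun q => F q t) (fun q => ν q t) p * ‖F p t‖)
            ≤ C * (1 + 1 / Real.sqrt t) := by
  have hsin : 0 < Real.sin θ₁ :=
    Real.sin_pos_of_pos_of_lt_pi hθ₁.1 (by linarith [hθ₁.2, Real.pi_pos])
  -- Half of the opening sin θ₁ is spent on the concave term -ε|x|, and the other half keeps φ ≥
  -- ε|x|.
  set ε := Real.sin θ₁ / 2 with hε_def
  have hε : 0 < ε := by positivity
  have hε1 : ε ≤ 1 := by linarith [Real.sin_le_one θ₁]
  set B := 2 / ε ^ 2 * (3 / 2 + 8 / ε ^ 2) with hB_def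
  have hB : 0 < B := by positivity
  refine ⟨Real.sqrt (2 * B), Real.sqrt_pos.2 (by positivity), ?_⟩
  intro n hn M _ _ _ _ _ T hT F ν h hcone t ht p
  have hcone' : ∀ t ∈ Set.Icc 0 T, ∀ q, 2 * ε * ‖F q t‖
      ≤ inner ℝ (F q t) (EuclideanSpace.single (Fin.last n) (1 : ℝ)) := by
    intro s hs q
    rw [hε_def, mul_div_cancel₀ _ two_ne_zero]
    exact hcone s hs q
  have hne : ∀ s ∈ Set.Icc 0 T, F p s ≠ 0 := fun s hs =>
    h.position_ne_zero (by omega) hε hs (hcone' s hs) p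
  have htI : t ∈ Set.Icc 0 T := Set.Ioc_subset_Icc_self ht
  refine ⟨hne t htI, ?_⟩
  have hsq := h.sq_div_norm_le_of_Ioo hT p hne (B := B)
    (fun s hs => h.sq_div_norm_le hn hε hε1 (by simp) hcone' hs p) t ht
  have ht0 : 0 < t := ht.1
  have hst : 0 < Real.sqrt t := Real.sqrt_pos.2 ht0
  rw [one_div, mul_inv, ← div_eq_mul_inv]
  refine abs_le_of_sq_le_sq' ?_ (by positivity) |>.2
  refine hsq.trans ?_
  rw [mul_pow, Real.sq_sqrt (by positivity)]
  have h1 : (1 / Real.sqrt t) ^ 2 = 1 / t := by rw [div_pow, one_pow, Real.sq_sqrt ht0.le]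
  have h2 : 0 < 1 / Real.sqrt t := by positivity
  -- The factor 2 here is the one inside the square root defining the constant.
  have h3 : 1 + 2 / t ≤ 2 * (1 + 1 / Real.sqrt t) ^ 2 := by
    have h4 : (2 : ℝ) / t = 2 * (1 / t) := by ring
    rw [h4, ← h1]
    nlinarith
  calc B * (1 + 2 / t) ≤ B * (2 * (1 + 1 / Real.sqrt t) ^ 2) := mul_le_mul_of_nonneg_left h3 hB.le
    _ = 2 * B * (1 + 1 / Real.sqrt t) ^ 2 := by ring
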